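/- Let $\mathcal D$ be the set of dyadic intervals $[k2^{-n},(k+1)2^{-n})$, $n\ge 0$, $0\le k<2^n$, contained in $[0,1)$, and for $I\in\mathcal D$ let $h_I=\chi_{I_0}-\chi_{I_1}$ be the $L^\infty$-normalized Haar function, where $I_0$ and $I_1$ are the left and right halves of $I$. Let $SL^\infty$ be the real Banach space of all formal series $f=\sum_{I\in\mathcal D}a_Ih_I$ (identified with their coefficient vectors $(a_I)_{I\in\mathcal D}\in\mathbb R^{\mathcal D}$) for which $$\|f\|_{SL^\infty}=\Big\|\Big(\sum_{I\in\mathcal D}a_I^2h_I^2\Big)^{1/2}\Big\|_{L^\infty[0,1)}<\infty ,$$ and for $n\ge 0$ let $SL^\infty_n=\operatorname{span}\{h_I : I\in\mathcal D,\ |I|\ge 2^{-n}\}\subset SL^\infty$. For $1\le r\le\infty$ let $X^{(r)}=\big(\sum_{n\ge 0}SL^\infty_n\big)_r$ denote the $\ell^r$-direct sum of these spaces. "Operator" means bounded linear map. A Banach space $X$ is called primary if for every bounded projection $Q:X\to X$ at least one of $Q(X)$, $(\mathrm{Id}-Q)(X)$ is isomorphic to $X$. Let $1\le r\le\infty$.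 Then for every operator $T:X^{(r)}\to X^{(r)}$ and every $\eta>0$ there exist operators $R,S:X^{(r)}\to X^{(r)}$ such that, for $H=T$ or for $H=\mathrm{Id}_{X^{(r)}}-T$, $$\mathrm{Id}_{X^{(r)}}=S\,H\,R\qquad\text{and}\qquad \|R\|\,\|S\|\le 2+\eta .$$ Consequently, $X^{(r)}$ is primary for every $1\le r\le\infty$, and $SL^\infty$ is primary. -/

import Mathlib

open MeasureTheory Set
open scoped ENNReal

/-- The dyadic intervals contained in `[0,1)`: the pair `⟨n, k⟩` with `0 ≤ k < 2 ^ n` stands for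
the interval `[k * 2⁻ⁿ, (k + 1) * 2⁻ⁿ)`. -/
abbrev DyadicInterval : Type := Σ n : ℕ, Fin (2 ^ n)

namespace DyadicInterval

/-- The left half of a dyadic interval. -/
def leftHalf (I : DyadicInterval) : Set ℝ :=
  Ico ((I.2 : ℝ) / 2 ^ I.1) (((I.2 : ℝ) + 1 / 2) / 2 ^ I.1)

/-- The right half of a dyadic interval. -/
def rightHalf (I : DyadicInterval) : Set ℝ :=
  Ico (((I.2 : ℝ) + 1 / 2) / 2 ^ I.1) (((I.2 : ℝ) + 1) / 2 ^ I.1)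

/-- The `L^∞`-normalized Haar function `h_I = χ_{I₀} - χ_{I₁}`, where `I₀` and `I₁` are the left
and the right half of `I`. -/
noncomputable def haar (I : DyadicInterval) (x : ℝ) : ℝ :=
  I.leftHalf.indicator 1 x - I.rightHalf.indicator 1 x

/-- The collection of all dyadic intervals of length at least `2⁻ⁿ`. -/
def upTo (n : ℕ) : Set DyadicInterval := {I | I.1 ≤ n}

theorem finite_upTo (n : ℕ) : (upTo n).Finite := by
  have h : upTo n ⊆ ⋃ m ∈ Set.Iic n, Set.range (fun k : Fin (2 ^ m) => (⟨m, k⟩ : DyadicInterval)) := by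
    rintro ⟨m, k⟩ hm
    simp only [mem_iUnion]
    exact ⟨m, hm, k, rfl⟩
  exact ((Set.finite_Iic n).biUnion fun m _ => Set.finite_range _).subset h

theorem measurable_haar (I : DyadicInterval) : Measurable I.haar := by
  unfold haar leftHalf rightHalf
  exact (measurable_one.indicator measurableSet_Ico).sub
    (measurable_one.indicator measurableSet_Ico)

theorem haar_eq_one_of_mem {I : DyadicInterval} {x : ℝ} (hx : x ∈ I.leftHalf) : I.haar x = 1 := by
  have h2 : x ∉ I.rightHalf := fun h => absurd hx.2 (not_lt.mpr h.1)
  simp [haar, indicator_of_mem hx, indicator_of_notMem h2]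

theorem haar_sq_le_one (I : DyadicInterval) (x : ℝ) : I.haar x ^ 2 ≤ 1 := by
  unfold haar
  by_cases h1 : x ∈ I.leftHalf <;> by_cases h2 : x ∈ I.rightHalf <;> simp [h1, h2]

theorem volume_leftHalf_pos (I : DyadicInterval) :
    0 < (volume.restrict (Ico (0 : ℝ) 1)) I.leftHalf := by
  have hp : (0 : ℝ) < 2 ^ I.1 := by positivity
  have hk : ((I.2 : ℕ) : ℝ) + 1 ≤ 2 ^ I.1 := by exact_mod_cast I.2.2
  have hsub : I.leftHalf ⊆ Ico (0 : ℝ) 1 := by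
    refine Ico_subset_Ico (by positivity) ?_
    rw [div_le_one hp]
    linarith
  rw [Measure.restrict_apply (by unfold leftHalf; exact measurableSet_Ico),
    inter_eq_left.mpr hsub, leftHalf, Real.volume_Ico, ENNReal.ofReal_pos, sub_pos]
  gcongr
  linarith

end DyadicInterval

open DyadicInterval

/-- Formal Haar series `∑ a_I h_I`, that is, families of real coefficients indexed by the dyadic
intervals. (A type synonym, so that it does not carry the product topology.) -/
def HaarSeries : Type := DyadicInterval → ℝ

namespace HaarSeries

instance : AddCommGroup HaarSeries := inferInstanceAs (AddCommGroup (DyadicInterval → ℝ))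

noncomputable instance : Module ℝ HaarSeries :=
  inferInstanceAs (Module ℝ (DyadicInterval → ℝ))

/-- The family of coefficients of a Haar series; `a I` is the coefficient `a_I`. -/
def coeff (a : HaarSeries) : DyadicInterval → ℝ := a

instance : CoeFun HaarSeries fun _ => DyadicInterval → ℝ := ⟨coeff⟩

/-- The Haar series with given coefficients. -/
def ofCoeff (c : DyadicInterval → ℝ) : HaarSeries := c

@[simp] theorem ofCoeff_apply (c : DyadicInterval → ℝ) (I : DyadicInterval) :
    (ofCoeff c) I = c I := rfl

@[ext] theorem ext {a b : HaarSeries} (h : ∀ I, a I = b I) : a = b := funext h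

@[simp] theorem add_apply (a b : HaarSeries) (I : DyadicInterval) : (a + b) I = a I + b I := rfl
@[simp] theorem sub_apply (a b : HaarSeries) (I : DyadicInterval) : (a - b) I = a I - b I := rfl
@[simp] theorem neg_apply (a : HaarSeries) (I : DyadicInterval) : (-a) I = -a I := rfl
@[simp] theorem zero_apply (I : DyadicInterval) : (0 : HaarSeries) I = 0 := rfl
@[simp] theorem smul_apply (c : ℝ) (a : HaarSeries) (I : DyadicInterval) :
    (c • a) I = c * a I := rfl

/-- The square function `x ↦ (∑_I a_I² h_I(x)²)^{1/2}`, with values in `[0,∞]`. -/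
noncomputable def squareFunction (a : HaarSeries) (x : ℝ) : ℝ≥0∞ :=
  (∑' I : DyadicInterval, ENNReal.ofReal (a I ^ 2 * I.haar x ^ 2)) ^ (1 / 2 : ℝ)

/-- The `SL^∞` norm of a Haar series: the `L^∞[0,1)` norm of its square function, as an extended
nonnegative number. -/
noncomputable def slNorm (a : HaarSeries) : ℝ≥0∞ :=
  essSup a.squareFunction (volume.restrict (Ico (0 : ℝ) 1))

theorem ofReal_sq_mul (s t : ℝ) :
    ENNReal.ofReal (s ^ 2 * t ^ 2) = ENNReal.ofReal |s * t| ^ (2 : ℝ) := by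
  rw [ENNReal.ofReal_rpow_of_nonneg (abs_nonneg _) (by norm_num), ← mul_pow, ← sq_abs]
  norm_num

theorem squareFunction_eq (a : HaarSeries) (x : ℝ) :
    a.squareFunction x =
      (∑' I : DyadicInterval, ENNReal.ofReal |a I * I.haar x| ^ (2 : ℝ)) ^ (1 / 2 : ℝ) := by
  simp only [squareFunction, ofReal_sq_mul]

theorem squareFunction_add_le (a b : HaarSeries) (x : ℝ) :
    (a + b).squareFunction x ≤ a.squareFunction x + b.squareFunction x := by
  let _ : MeasurableSpace DyadicInterval := ⊤
  simp only [squareFunction_eq]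
  have key := ENNReal.lintegral_Lp_add_le (μ := (Measure.count : Measure DyadicInterval))
    (p := 2) (f := fun I => ENNReal.ofReal |a I * I.haar x|)
    (g := fun I => ENNReal.ofReal |b I * I.haar x|)
    (measurable_from_top.aemeasurable) (measurable_from_top.aemeasurable) (by norm_num)
  simp only [lintegral_count] at key
  refine le_trans ?_ key
  gcongr with I
  rw [Pi.add_apply, ← ENNReal.ofReal_add (abs_nonneg _) (abs_nonneg _), add_apply, add_mul]
  exact ENNReal.ofReal_le_ofReal (abs_add_le _ _)

theorem squareFunction_smul (c : ℝ) (a : HaarSeries) (x : ℝ) :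
    (c • a).squareFunction x = ENNReal.ofReal |c| * a.squareFunction x := by
  simp only [squareFunction_eq, smul_apply, mul_assoc, abs_mul c]
  simp only [ENNReal.ofReal_mul (abs_nonneg c),
    ENNReal.mul_rpow_of_nonneg _ _ (by norm_num : (0 : ℝ) ≤ 2), ENNReal.tsum_mul_left]
  rw [ENNReal.mul_rpow_of_nonneg _ _ (by norm_num), ← ENNReal.rpow_mul]
  norm_num

theorem slNorm_add_le (a b : HaarSeries) : (a + b).slNorm ≤ a.slNorm + b.slNorm :=
  (essSup_mono_ae (Filter.Eventually.of_forall (squareFunction_add_le a b))).trans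
    (ENNReal.essSup_add_le _ _)

theorem slNorm_smul (c : ℝ) (a : HaarSeries) :
    (c • a).slNorm = ENNReal.ofReal |c| * a.slNorm := by
  rw [slNorm, slNorm, ← ENNReal.essSup_const_mul]
  congr 1
  funext x
  exact squareFunction_smul c a x

theorem slNorm_zero : (0 : HaarSeries).slNorm = 0 := by
  have := slNorm_smul 0 (0 : HaarSeries)
  simpa using this

theorem squareFunction_le_iff (a : HaarSeries) (x : ℝ) (C : ℝ≥0∞) :
    a.squareFunction x ≤ C ↔ ∀ F : Finset DyadicInterval,
      ∑ I ∈ F, ENNReal.ofReal (a I ^ 2 * I.haar x ^ 2) ≤ C ^ (2 : ℝ) := by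
  rw [squareFunction, one_div, ENNReal.rpow_inv_le_iff (by norm_num), ENNReal.tsum_eq_iSup_sum,
    iSup_le_iff]

theorem ofReal_abs_le_slNorm (a : HaarSeries) (I : DyadicInterval) :
    ENNReal.ofReal |a I| ≤ a.slNorm := by
  by_contra! hlt
  have hae : ∀ᵐ x ∂(volume.restrict (Ico (0 : ℝ) 1)), x ∉ I.leftHalf := by
    filter_upwards [ENNReal.ae_le_essSup a.squareFunction] with x hx hmem
    refine absurd (hx.trans_lt hlt) (not_lt.mpr ?_)
    rw [squareFunction_eq, one_div, ENNReal.le_rpow_inv_iff (by norm_num)]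
    refine le_trans (le_of_eq ?_) (ENNReal.le_tsum I)
    rw [haar_eq_one_of_mem hmem, mul_one]
  have h0 : (volume.restrict (Ico (0 : ℝ) 1)) I.leftHalf = 0 := by
    simpa only [ae_iff, not_not, ofPred_mem_eq] using hae
  exact (volume_leftHalf_pos I).ne' h0

open Classical in
/-- The Haar function `h_I` as a Haar series. -/
noncomputable def single (I : DyadicInterval) : HaarSeries :=
  ofCoeff (Pi.single I 1)

theorem slNorm_single_le (I : DyadicInterval) : (single I).slNorm ≤ 1 := by
  refine essSup_le_of_ae_le _ (Filter.Eventually.of_forall fun x => ?_)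
  rw [squareFunction, tsum_eq_single I]
  · refine ENNReal.rpow_le_one ?_ (by norm_num)
    rw [ENNReal.ofReal_le_one]
    simpa [single] using haar_sq_le_one I x
  · intro J hJ
    simp [single, hJ]

end HaarSeries

/-- The space `SL^∞` of all Haar series `∑ a_I h_I` whose square function is essentially bounded.
(Elements are identified with their vectors of coefficients. Convergence of the series in `L²` is
automatic, because `∑ a_I² |I|` is the integral of the squared square function.) -/
def SLInfty : Submodule ℝ HaarSeries where
  carrier := {a | a.slNorm < ∞}
  zero_mem' := by simp [HaarSeries.slNorm_zero]
  add_mem' {a b} ha hb :=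
    (HaarSeries.slNorm_add_le a b).trans_lt (ENNReal.add_lt_top.mpr ⟨ha, hb⟩)
  smul_mem' c a ha := by
    change (c • a).slNorm < ∞
    rw [HaarSeries.slNorm_smul]
    exact ENNReal.mul_lt_top ENNReal.ofReal_lt_top ha

namespace SLInfty

noncomputable instance : Norm SLInfty := ⟨fun f => (f : HaarSeries).slNorm.toReal⟩

theorem norm_def (f : SLInfty) : ‖f‖ = (f : HaarSeries).slNorm.toReal := rfl

theorem ofReal_norm (f : SLInfty) : ENNReal.ofReal ‖f‖ = (f : HaarSeries).slNorm :=
  ENNReal.ofReal_toReal f.2.ne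

theorem abs_coeff_le_norm (f : SLInfty) (I : DyadicInterval) : |(f : HaarSeries) I| ≤ ‖f‖ := by
  refine (ENNReal.ofReal_le_ofReal_iff ENNReal.toReal_nonneg).mp ?_
  exact (HaarSeries.ofReal_abs_le_slNorm _ I).trans_eq (ofReal_norm f).symm

theorem core : NormedSpace.Core ℝ SLInfty where
  norm_nonneg _ := ENNReal.toReal_nonneg
  norm_smul c f := by
    rw [norm_def, norm_def, Submodule.coe_smul, HaarSeries.slNorm_smul, ENNReal.toReal_mul,
      ENNReal.toReal_ofReal (abs_nonneg c), Real.norm_eq_abs]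
  norm_triangle f g := by
    rw [norm_def, norm_def, norm_def, ← ENNReal.toReal_add f.2.ne g.2.ne]
    exact ENNReal.toReal_mono (ENNReal.add_ne_top.mpr ⟨f.2.ne, g.2.ne⟩)
      (HaarSeries.slNorm_add_le _ _)
  norm_eq_zero_iff f := by
    constructor
    · intro h
      ext I
      have := abs_coeff_le_norm f I
      rw [h] at this
      simpa using this
    · rintro rfl
      simp [norm_def, HaarSeries.slNorm_zero]

noncomputable instance : NormedAddCommGroup SLInfty := NormedAddCommGroup.ofCore core

noncomputable instance : NormedSpace ℝ SLInfty := NormedSpace.ofCore core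

instance : CompleteSpace SLInfty := by
  refine Metric.complete_of_cauchySeq_tendsto fun u hu => ?_
  have hcoeff : ∀ I : DyadicInterval, CauchySeq fun k => (u k : HaarSeries) I := by
    intro I
    rw [Metric.cauchySeq_iff] at hu ⊢
    intro ε hε
    obtain ⟨N, hN⟩ := hu ε hε
    refine ⟨N, fun m hm n hn => lt_of_le_of_lt ?_ (hN m hm n hn)⟩
    rw [Real.dist_eq, dist_eq_norm]
    exact abs_coeff_le_norm (u m - u n) I
  choose a ha using fun I => cauchySeq_tendsto_of_complete (hcoeff I)
  let A : HaarSeries := HaarSeries.ofCoeff a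
  have key : ∀ ε : ℝ, 0 < ε → ∃ N, ∀ k ≥ N,
      ((u k : HaarSeries) - A).slNorm ≤ ENNReal.ofReal ε := by
    intro ε hε
    rw [Metric.cauchySeq_iff] at hu
    obtain ⟨N, hN⟩ := hu ε hε
    refine ⟨N, fun k hk => essSup_le_of_ae_le _ ?_⟩
    have hae : ∀ᵐ x ∂(volume.restrict (Ico (0 : ℝ) 1)), ∀ l : ℕ, N ≤ l →
        ((u k - u l : SLInfty) : HaarSeries).squareFunction x ≤ ENNReal.ofReal ε := by
      rw [ae_all_iff]
      intro l
      filter_upwards [ENNReal.ae_le_essSup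
        ((u k - u l : SLInfty) : HaarSeries).squareFunction] with x hx hl
      refine hx.trans ?_
      change ((u k - u l : SLInfty) : HaarSeries).slNorm ≤ _
      rw [← ofReal_norm, ← dist_eq_norm]
      exact ENNReal.ofReal_le_ofReal (hN k hk l hl).le
    filter_upwards [hae] with x hx
    rw [HaarSeries.squareFunction_le_iff]
    intro F
    refine le_of_tendsto (f := fun l => ∑ I ∈ F, ENNReal.ofReal
      (((u k - u l : SLInfty) : HaarSeries) I ^ 2 * I.haar x ^ 2)) (x := Filter.atTop) ?_ ?_
    · refine tendsto_finsetSum F fun I _ => ENNReal.tendsto_ofReal ?_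
      exact ((tendsto_const_nhds.sub (ha I)).pow 2).mul_const _
    · filter_upwards [Filter.eventually_ge_atTop N] with l hl
      exact (HaarSeries.squareFunction_le_iff _ _ _).mp (hx l hl) F
  obtain ⟨N, hN⟩ := key 1 one_pos
  have hA : A ∈ SLInfty := by
    have h1 : (u N : HaarSeries) - A ∈ SLInfty :=
      (hN N le_rfl).trans_lt ENNReal.ofReal_lt_top
    have h2 := SLInfty.sub_mem (u N).2 h1
    rwa [sub_sub_cancel] at h2
  refine ⟨⟨A, hA⟩, Metric.tendsto_atTop.mpr fun ε hε => ?_⟩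
  obtain ⟨M, hM⟩ := key (ε / 2) (half_pos hε)
  refine ⟨M, fun k hk => ?_⟩
  rw [dist_eq_norm]
  refine lt_of_le_of_lt ?_ (half_lt_self hε)
  rw [← ENNReal.ofReal_le_ofReal_iff (half_pos hε).le, ofReal_norm]
  exact hM k hk

/-- The Haar function `h_I` as an element of `SL^∞`. -/
noncomputable def haarVec (I : DyadicInterval) : SLInfty :=
  ⟨HaarSeries.single I, (HaarSeries.slNorm_single_le I).trans_lt ENNReal.one_lt_top⟩

end SLInfty

/-- The finite dimensional space `SL^∞_n`: the linear span in `SL^∞` of all `h_I` with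
`|I| ≥ 2⁻ⁿ`, equipped with the norm of `SL^∞`. -/
noncomputable def SLInftyFin (n : ℕ) : Submodule ℝ SLInfty :=
  Submodule.span ℝ (SLInfty.haarVec '' DyadicInterval.upTo n)

instance (n : ℕ) : FiniteDimensional ℝ (SLInftyFin n) :=
  FiniteDimensional.span_of_finite ℝ ((DyadicInterval.finite_upTo n).image _)

instance (n : ℕ) : CompleteSpace (SLInftyFin n) := FiniteDimensional.complete ℝ _

/-- The direct sum `X^{(r)} = (∑_{n ≥ 0} SL^∞_n)_r`. -/
abbrev SLSum (r : ℝ≥0∞) : Type := lp (fun n : ℕ => SLInftyFin n) r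

/-- A Banach space `X` is primary if for every bounded projection `Q` on `X`, the range of `Q` or
the range of `Id - Q` is isomorphic to `X`. -/
def IsPrimaryBanach (X : Type*) [NormedAddCommGroup X] [NormedSpace ℝ X] [CompleteSpace X] :
    Prop :=
  ∀ Q : X →L[ℝ] X, Q ∘L Q = Q →
    Nonempty (LinearMap.range (Q : X →ₗ[ℝ] X) ≃L[ℝ] X) ∨
      Nonempty (LinearMap.range ((ContinuousLinearMap.id ℝ X - Q : X →L[ℝ] X) : X →ₗ[ℝ] X) ≃L[ℝ] X)

/-!
The `SL^∞` norm of a Haar series is the supremum, over all branches of the dyadic tree, of the `ℓ²`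
norm of the coefficients along the branch (`HaarSeries.slNorm_le_iff`). Dyadic intervals are coded
by finite `0`-`1` words throughout. Consequently every embedding of the tree of words of length at
most `n` into a larger tree induces a norm one embedding of `SL^∞_n` with a norm one left inverse:
single Haar functions are sent to single Haar functions, and no averaging over blocks is needed.

*Factorization.* Let `T` be an operator on `X^{(r)}`. Every functional satisfies a Bessel inequality
on the Haar functions of a block, and the coefficients of every vector are square summable along
branches. A Haar function therefore interacts significantly with a bounded number of nodes of any
branch only, and descending far enough along branches yields, in every large enough block, trees of
any prescribed depth on which the matrix of `T` is almost diagonal (`exists_sparse_tree`,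
`exists_block_tree`). By the Ramsey property of trees (`exists_monochromatic_tree`) and by passing to
a subsequence of blocks, the diagonal entries of `T` are all at least `1/2` in absolute value, or
they are all smaller, in which case those of `Id - T` are at least `1/2`. Restricting to this system
and dividing by the diagonal, which costs a factor `2`, gives a small perturbation of the identity
(`SparseSystem.exists_factorization`). For `r = ∞` an operator is not determined by its matrix; this
is repaired by restricting to a suitable infinite set of blocks from an uncountable almost disjoint
family (`exists_infinite_forall_hasSum`).

*Primariness.* `ℓ^r(X^{(r)})` is complemented in `X^{(r)}` (`idFactorsThrough_lp_SLSum`), so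
Pełczyński's decomposition method (`IdFactorsThrough.nonempty_equiv_lp`) turns the factorization into
primariness. For `SL^∞`, the same method shows that it is isomorphic to `X^{(∞)}`: each of the two
spaces is complemented in the other (`idFactorsThrough_SLSum_SLInfty`,
`idFactorsThrough_SLInfty_SLSum`).
-/

/-! ### Embeddings of finite dyadic trees -/

/-- A map `φ` of finite `0`-`1` words embeds the tree of all words of length less than `p` into the
tree of all words: whenever `J` lies below the child `I b` of `I`, the word `φ J` lies below the
child `(φ I) b` of `φ I`. Values of `φ` on words of length at least `p` are irrelevant. -/
def IsTreeEmb (p : ℕ) (φ : List Bool → List Bool) : Prop :=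
  ∀ (I J : List Bool) (b : Bool), J.length < p → I ++ [b] <+: J → φ I ++ [b] <+: φ J

/-- Two words are comparable, or they branch off in different directions at a common prefix. -/
theorem prefix_trichotomy (I J : List Bool) :
    I <+: J ∨ J <+: I ∨ ∃ u b, u ++ [b] <+: I ∧ u ++ [!b] <+: J := by
  induction I generalizing J with
  | nil => exact Or.inl List.nil_prefix
  | cons a I ih =>
    cases J with
    | nil => exact Or.inr (Or.inl List.nil_prefix)
    | cons c J =>
      by_cases hac : a = c
      · subst hac
        rcases ih J with h | h | ⟨u, b, h1, h2⟩
        · exact Or.inl (by simpa using h)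
        · exact Or.inr (Or.inl (by simpa using h))
        · exact Or.inr (Or.inr ⟨a :: u, b, by simpa using h1, by simpa using h2⟩)
      · refine Or.inr (Or.inr ⟨[], a, by simp, ?_⟩)
        have : c = !a := by cases a <;> cases c <;> simp_all
        simp [this]

/-- A proper extension of `I` lies below one of the children of `I`. -/
theorem exists_child_prefix {I J : List Bool} (h : I <+: J) (hne : I ≠ J) :
    ∃ b, I ++ [b] <+: J := by
  obtain ⟨t, rfl⟩ := h
  cases t with
  | nil => simp at hne
  | cons b t => exact ⟨b, t, by simp⟩

theorem child_prefix_unique {u z : List Bool} {b : Bool} (h1 : u ++ [b] <+: z)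
    (h2 : u ++ [!b] <+: z) : False := by
  have h := List.prefix_of_prefix_length_le h1 h2 (by simp)
  simp at h

namespace IsTreeEmb

variable {p : ℕ} {φ : List Bool → List Bool}

theorem mono {q : ℕ} (h : IsTreeEmb p φ) (hqp : q ≤ p) : IsTreeEmb q φ :=
  fun I J b hJ => h I J b (hJ.trans_le hqp)

theorem comp {q : ℕ} {θ : List Bool → List Bool} (h : IsTreeEmb p φ) (hθ : IsTreeEmb q θ)
    (hlen : ∀ J : List Bool, J.length < q → (θ J).length < p) : IsTreeEmb q (φ ∘ θ) :=
  fun I J b hJ hIJ => h _ _ b (hlen J hJ) (hθ I J b hJ hIJ)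

theorem prefix_and_length_lt (h : IsTreeEmb p φ) {I J : List Bool} (hJ : J.length < p)
    (hIJ : I <+: J) (hne : I ≠ J) : φ I <+: φ J ∧ (φ I).length < (φ J).length := by
  obtain ⟨b, hb⟩ := exists_child_prefix hIJ hne
  have h1 := h I J b hJ hb
  refine ⟨(List.prefix_append _ _).trans h1, ?_⟩
  have := h1.length_le
  simp at this
  omega

/-- Tree embeddings reflect the prefix order, strictly. -/
theorem prefix_of_prefix (h : IsTreeEmb p φ) {I J : List Bool} (hI : I.length < p)
    (hJ : J.length < p) (hIJ : φ I <+: φ J) : I <+: J := by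
  rcases prefix_trichotomy I J with h1 | h1 | ⟨u, b, h1, h2⟩
  · exact h1
  · by_cases hne : J = I
    · exact hne ▸ List.prefix_refl _
    · have := (h.prefix_and_length_lt hI h1 hne).2
      have := hIJ.length_le
      omega
  · exact (child_prefix_unique ((h u I b hI h1).trans hIJ) (h u J _ hJ h2)).elim

theorem injective (h : IsTreeEmb p φ) {I J : List Bool} (hI : I.length < p)
    (hJ : J.length < p) (hIJ : φ I = φ J) : I = J := by
  have h1 := h.prefix_of_prefix hI hJ (hIJ ▸ List.prefix_refl _)
  have h2 := h.prefix_of_prefix hJ hI (hIJ ▸ List.prefix_refl _)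
  exact h1.eq_of_length_le h2.length_le

end IsTreeEmb

/-- The map of words sending the root to `K` and acting as `φ₀` and `φ₁` on the two subtrees. -/
def glueTree (K : List Bool) (φ₀ φ₁ : List Bool → List Bool) : List Bool → List Bool
  | [] => K
  | false :: w => φ₀ w
  | true :: w => φ₁ w

theorem isTreeEmb_glueTree {p : ℕ} {K : List Bool} {φ₀ φ₁ : List Bool → List Bool}
    (h₀ : IsTreeEmb p φ₀) (h₁ : IsTreeEmb p φ₁)
    (hK₀ : ∀ J : List Bool, J.length < p → K ++ [false] <+: φ₀ J)
    (hK₁ : ∀ J : List Bool, J.length < p → K ++ [true] <+: φ₁ J) :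
    IsTreeEmb (p + 1) (glueTree K φ₀ φ₁) := by
  intro I J b hJ hIJ
  cases J with
  | nil => simp at hIJ
  | cons c J =>
    have hJ' : J.length < p := by simpa using hJ
    cases I with
    | nil =>
      have : b = c := by simpa using hIJ
      subst this
      cases b
      · exact hK₀ J hJ'
      · exact hK₁ J hJ'
    | cons a I =>
      obtain ⟨rfl, h⟩ : a = c ∧ I ++ [b] <+: J := by simpa using hIJ
      cases a
      · exact h₀ I J b hJ' h
      · exact h₁ I J b hJ' h

/-- The words of length less than `p`. -/
noncomputable def shortWords (p : ℕ) : Finset (List Bool) := (List.finite_length_lt Bool p).toFinset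

@[simp] theorem mem_shortWords {p : ℕ} {w : List Bool} : w ∈ shortWords p ↔ w.length < p := by
  simp [shortWords]

/-- The `i`-th node of the leftmost branch starting at `v`. -/
def leftChain (v : List Bool) (i : ℕ) : List Bool := v ++ List.replicate i false

theorem exists_le_of_sum_chain_le {g : List Bool → ℝ} {v : List Bool} {C δ : ℝ} {L : ℕ}
    (hL : C < L * δ) (hg : ∑ i ∈ Finset.range L, g (leftChain v i) ≤ C) :
    ∃ i < L, g (leftChain v i) ≤ δ := by
  by_contra! h
  have : ∑ i ∈ Finset.range L, δ ≤ ∑ i ∈ Finset.range L, g (leftChain v i) :=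
    Finset.sum_le_sum fun i hi => (h i (Finset.mem_range.mp hi)).le
  simp at this
  linarith

/-- If a symmetric cost function on pairs of words and a cost function on words have bounded sums
along leftmost branches, then some tree embedding of depth `p` below any given node has only cheap
values and cheap pairs of values. The depth `N` needed depends on the bounds only. The embedding is
built greedily: the root first, then the left subtree, then the right one, always descending along
leftmost branches. -/
theorem exists_sparse_tree (C : ℝ) {δ : ℝ} (hδ : 0 < δ) (p : ℕ) : ∀ C₀ : ℝ, ∃ N : ℕ,
    ∀ (c : List Bool → List Bool → ℝ) (g : List Bool → ℝ) (v : List Bool),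
      (∀ u w, 0 ≤ c u w) → (∀ u w, c u w = c w u) →
      (∀ u v L, ∑ i ∈ Finset.range L, c u (leftChain v i) ≤ C) →
      (∀ w, 0 ≤ g w) → (∀ v L, ∑ i ∈ Finset.range L, g (leftChain v i) ≤ C₀) →
      ∃ φ, IsTreeEmb p φ ∧
        (∀ J : List Bool, J.length < p → v <+: φ J ∧ (φ J).length ≤ v.length + N ∧ g (φ J) ≤ δ) ∧
        (∀ I J : List Bool, I.length < p → J.length < p → I ≠ J → c (φ I) (φ J) ≤ δ) := by
  induction p with
  | zero => exact fun C₀ => ⟨0, fun c g v _ _ _ _ _ => ⟨id, by simp [IsTreeEmb], by simp, by simp⟩⟩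
  | succ p ih =>
    intro C₀
    obtain ⟨L, hL⟩ := exists_nat_gt (C₀ / δ)
    rw [div_lt_iff₀ hδ] at hL
    obtain ⟨N₀, hN₀⟩ := ih (C₀ + C)
    obtain ⟨N₁, hN₁⟩ := ih (C₀ + C + (shortWords p).card * C)
    refine ⟨L + 1 + max N₀ N₁, fun c g v hc hsymm hcC hg hgC => ?_⟩
    obtain ⟨i, hi, hgi⟩ := exists_le_of_sum_chain_le hL (hgC v L)
    set K := leftChain v i with hK
    have hvK : v <+: K := List.prefix_append _ _
    have hKlen : K.length = v.length + i := by simp [hK, leftChain]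
    obtain ⟨φ₀, hφ₀, hg₀, hc₀⟩ := hN₀ c (fun w => g w + c K w) (K ++ [false]) hc hsymm hcC
      (fun w => add_nonneg (hg w) (hc _ _))
      (fun v L => by rw [Finset.sum_add_distrib]; exact add_le_add (hgC v L) (hcC K v L))
    obtain ⟨φ₁, hφ₁, hg₁, hc₁⟩ := hN₁ c
      (fun w => g w + c K w + ∑ I ∈ shortWords p, c (φ₀ I) w) (K ++ [true]) hc hsymm hcC
      (fun w => add_nonneg (add_nonneg (hg w) (hc _ _)) (Finset.sum_nonneg fun _ _ => hc _ _))
      (fun v L => by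
        rw [Finset.sum_add_distrib, Finset.sum_add_distrib, Finset.sum_comm]
        refine add_le_add (add_le_add (hgC v L) (hcC K v L)) ?_
        rw [← nsmul_eq_mul]
        exact Finset.sum_le_card_nsmul _ _ _ fun I _ => hcC _ v L)
    have hKφ₁ : ∀ J : List Bool, J.length < p → c K (φ₁ J) ≤ δ := fun J hJ => by
      have h1 := (hg₁ J hJ).2.2
      have h2 := hg (φ₁ J)
      have h3 : 0 ≤ ∑ I ∈ shortWords p, c (φ₀ I) (φ₁ J) := Finset.sum_nonneg fun _ _ => hc _ _
      linarith
    have hKφ₀ : ∀ J : List Bool, J.length < p → c K (φ₀ J) ≤ δ := fun J hJ => by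
      have h1 := (hg₀ J hJ).2.2
      have h2 := hg (φ₀ J)
      linarith
    have h01 : ∀ I J : List Bool, I.length < p → J.length < p → c (φ₀ I) (φ₁ J) ≤ δ :=
      fun I J hI hJ => by
        have h1 := (hg₁ J hJ).2.2
        have h2 := hg (φ₁ J)
        have h3 := hc K (φ₁ J)
        have h4 : c (φ₀ I) (φ₁ J) ≤ ∑ I ∈ shortWords p, c (φ₀ I) (φ₁ J) :=
          Finset.single_le_sum (f := fun I => c (φ₀ I) (φ₁ J)) (fun _ _ => hc _ _)
            (mem_shortWords.mpr hI)
        linarith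
    refine ⟨glueTree K φ₀ φ₁, isTreeEmb_glueTree hφ₀ hφ₁ (fun J hJ => (hg₀ J hJ).1)
      (fun J hJ => (hg₁ J hJ).1), ?_, ?_⟩
    · intro J hJ
      match J with
      | [] => exact ⟨hvK, by simp [glueTree]; omega, hgi⟩
      | false :: J =>
        have hJ' : J.length < p := by simpa using hJ
        obtain ⟨h1, h2, h3⟩ := hg₀ J hJ'
        refine ⟨(hvK.trans (List.prefix_append _ _)).trans h1, ?_, ?_⟩
        · simp only [glueTree]
          simp at h2
          omega
        · have := hc K (φ₀ J)
          simp only [glueTree]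
          linarith
      | true :: J =>
        have hJ' : J.length < p := by simpa using hJ
        obtain ⟨h1, h2, h3⟩ := hg₁ J hJ'
        refine ⟨(hvK.trans (List.prefix_append _ _)).trans h1, ?_, ?_⟩
        · simp only [glueTree]
          simp at h2
          omega
        · have := hc K (φ₁ J)
          have h3' : 0 ≤ ∑ I ∈ shortWords p, c (φ₀ I) (φ₁ J) :=
            Finset.sum_nonneg fun _ _ => hc _ _
          simp only [glueTree]
          linarith
    · intro I J hI hJ hIJ
      match I, J with
      | [], [] => exact absurd rfl hIJ
      | [], false :: J => exact hKφ₀ J (by simpa using hJ)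
      | [], true :: J => exact hKφ₁ J (by simpa using hJ)
      | false :: I, [] => rw [hsymm]; exact hKφ₀ I (by simpa using hI)
      | true :: I, [] => rw [hsymm]; exact hKφ₁ I (by simpa using hI)
      | false :: I, false :: J =>
        exact hc₀ I J (by simpa using hI) (by simpa using hJ) (by simpa using hIJ)
      | true :: I, true :: J =>
        exact hc₁ I J (by simpa using hI) (by simpa using hJ) (by simpa using hIJ)
      | false :: I, true :: J => exact h01 I J (by simpa using hI) (by simpa using hJ)
      | true :: I, false :: J =>
        rw [hsymm]; exact h01 J I (by simpa using hJ) (by simpa using hI)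

theorem exists_monochromatic_glue {p s : ℕ} {χ : List Bool → Prop} {v : List Bool} (hv : χ v)
    {θ₀ θ₁ : List Bool → List Bool} (h₀ : IsTreeEmb p θ₀) (h₁ : IsTreeEmb p θ₁)
    (hχ₀ : ∀ J : List Bool, J.length < p →
      v ++ [false] <+: θ₀ J ∧ (θ₀ J).length < (v ++ [false]).length + s ∧ χ (θ₀ J))
    (hχ₁ : ∀ J : List Bool, J.length < p →
      v ++ [true] <+: θ₁ J ∧ (θ₁ J).length < (v ++ [true]).length + s ∧ χ (θ₁ J)) :
    ∃ θ, IsTreeEmb (p + 1) θ ∧ ∀ J : List Bool, J.length < p + 1 →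
      v <+: θ J ∧ (θ J).length < v.length + (s + 1) ∧ χ (θ J) := by
  refine ⟨glueTree v θ₀ θ₁, isTreeEmb_glueTree h₀ h₁ (fun J hJ => (hχ₀ J hJ).1)
    (fun J hJ => (hχ₁ J hJ).1), fun J hJ => ?_⟩
  match J with
  | [] => exact ⟨List.prefix_refl _, by simp [glueTree], hv⟩
  | false :: J =>
    obtain ⟨h1, h2, h3⟩ := hχ₀ J (by simpa using hJ)
    refine ⟨(List.prefix_append _ _).trans h1, ?_, h3⟩
    simp at h2
    simp only [glueTree]
    omega
  | true :: J =>
    obtain ⟨h1, h2, h3⟩ := hχ₁ J (by simpa using hJ)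
    refine ⟨(List.prefix_append _ _).trans h1, ?_, h3⟩
    simp at h2
    simp only [glueTree]
    omega

/-- Ramsey property of dyadic trees: if the nodes of a tree with `p + q` levels are coloured with
two colours, there is an embedded tree with `p` levels in the first colour or an embedded tree with
`q` levels in the second one. -/
theorem exists_monochromatic_tree (χ : List Bool → Prop) (s : ℕ) : ∀ (p q : ℕ) (v : List Bool),
    p + q ≤ s →
    (∃ θ, IsTreeEmb p θ ∧ ∀ J : List Bool, J.length < p →
      v <+: θ J ∧ (θ J).length < v.length + s ∧ χ (θ J)) ∨
    (∃ θ, IsTreeEmb q θ ∧ ∀ J : List Bool, J.length < q →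
      v <+: θ J ∧ (θ J).length < v.length + s ∧ ¬ χ (θ J)) := by
  induction s with
  | zero =>
    intro p q v hpq
    obtain rfl : p = 0 := by omega
    exact Or.inl ⟨id, by simp [IsTreeEmb], by simp⟩
  | succ s ih =>
    intro p q v hpq
    rcases p with _ | p
    · exact Or.inl ⟨id, by simp [IsTreeEmb], by simp⟩
    rcases q with _ | q
    · exact Or.inr ⟨id, by simp [IsTreeEmb], by simp⟩
    have hstep : ∀ {b : Bool} {w : List Bool},
        v ++ [b] <+: w ∧ w.length < (v ++ [b]).length + s →
        v <+: w ∧ w.length < v.length + (s + 1) := fun {b w} h => by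
      refine ⟨(List.prefix_append _ _).trans h.1, ?_⟩
      have := h.2
      simp at this
      omega
    by_cases hv : χ v
    · rcases ih p (q + 1) (v ++ [false]) (by omega) with ⟨θ₀, h₀, hχ₀⟩ | ⟨θ, h, hχ⟩
      · rcases ih p (q + 1) (v ++ [true]) (by omega) with ⟨θ₁, h₁, hχ₁⟩ | ⟨θ, h, hχ⟩
        · exact Or.inl (exists_monochromatic_glue hv h₀ h₁ hχ₀ hχ₁)
        · exact Or.inr ⟨θ, h, fun J hJ =>
            and_assoc.mp ⟨hstep ⟨(hχ J hJ).1, (hχ J hJ).2.1⟩, (hχ J hJ).2.2⟩⟩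
      · exact Or.inr ⟨θ, h, fun J hJ =>
            and_assoc.mp ⟨hstep ⟨(hχ J hJ).1, (hχ J hJ).2.1⟩, (hχ J hJ).2.2⟩⟩
    · rcases ih (p + 1) q (v ++ [false]) (by omega) with ⟨θ, h, hχ⟩ | ⟨θ₀, h₀, hχ₀⟩
      · exact Or.inl ⟨θ, h, fun J hJ =>
            and_assoc.mp ⟨hstep ⟨(hχ J hJ).1, (hχ J hJ).2.1⟩, (hχ J hJ).2.2⟩⟩
      · rcases ih (p + 1) q (v ++ [true]) (by omega) with ⟨θ, h, hχ⟩ | ⟨θ₁, h₁, hχ₁⟩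
        · exact Or.inl ⟨θ, h, fun J hJ =>
            and_assoc.mp ⟨hstep ⟨(hχ J hJ).1, (hχ J hJ).2.1⟩, (hχ J hJ).2.2⟩⟩
        · exact Or.inr (exists_monochromatic_glue (χ := fun w => ¬ χ w) hv h₀ h₁ hχ₀ hχ₁)

/-! ### Words and dyadic intervals -/

/-- The natural number with a given binary expansion, most significant digit first. -/
def wordVal (w : List Bool) : ℕ := w.foldl (fun a b => 2 * a + b.toNat) 0

@[simp] theorem wordVal_nil : wordVal [] = 0 := rfl

@[simp] theorem wordVal_append_singleton (w : List Bool) (b : Bool) :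
    wordVal (w ++ [b]) = 2 * wordVal w + b.toNat := by
  simp [wordVal]

theorem wordVal_lt (w : List Bool) : wordVal w < 2 ^ w.length := by
  induction w using List.reverseRecOn with
  | nil => simp
  | append_singleton w b ih =>
    have := Bool.toNat_le b
    rw [wordVal_append_singleton, List.length_append, List.length_singleton, pow_succ]
    omega

/-- The dyadic interval obtained from `[0,1)` by choosing successively the left (`false`) or the
right (`true`) half. -/
def node (w : List Bool) : DyadicInterval := ⟨w.length, ⟨wordVal w, wordVal_lt w⟩⟩

theorem exists_word (n k : ℕ) (hk : k < 2 ^ n) :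
    ∃ w : List Bool, w.length = n ∧ wordVal w = k := by
  induction n generalizing k with
  | zero => exact ⟨[], rfl, by simp at hk; simp [hk]⟩
  | succ n ih =>
    obtain ⟨w, hw, hv⟩ := ih (k / 2) (by rw [pow_succ] at hk; omega)
    refine ⟨w ++ [decide (k % 2 = 1)], by simp [hw], ?_⟩
    rw [wordVal_append_singleton, hv]
    rcases Nat.mod_two_eq_zero_or_one k with h | h <;> simp [h] <;> omega

theorem word_ext {u w : List Bool} (hl : u.length = w.length) (hv : wordVal u = wordVal w) :
    u = w := by
  induction u using List.reverseRecOn generalizing w with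
  | nil => simpa using hl.symm
  | append_singleton u a ih =>
    rcases List.eq_nil_or_concat w with rfl | ⟨w, b, rfl⟩
    · simp at hl
    · rw [List.concat_eq_append] at *
      simp only [wordVal_append_singleton] at hv
      have ha := Bool.toNat_le a
      have hb := Bool.toNat_le b
      have hab : a.toNat = b.toNat := by omega
      rw [ih (by simpa using hl) (by omega), show a = b by cases a <;> cases b <;> simp_all]

theorem node_injective : Function.Injective node := by
  intro u w h
  have hl : u.length = w.length := congrArg Sigma.fst h
  have hv : wordVal u = wordVal w := congrArg (fun I : DyadicInterval => (I.2 : ℕ)) h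
  exact word_ext hl hv

theorem node_surjective : Function.Surjective node := by
  rintro ⟨n, k, hk⟩
  obtain ⟨w, rfl, rfl⟩ := exists_word n k hk
  exact ⟨w, rfl⟩

/-- The bijection between words and dyadic intervals. -/
noncomputable def nodeEquiv : List Bool ≃ DyadicInterval :=
  Equiv.ofBijective node ⟨node_injective, node_surjective⟩

/-- The dyadic interval attached to a word, as a set of reals. -/
def cell (w : List Bool) : Set ℝ :=
  Ico ((wordVal w : ℝ) / 2 ^ w.length) (((wordVal w : ℝ) + 1) / 2 ^ w.length)

theorem mem_cell_iff {w : List Bool} {x : ℝ} :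
    x ∈ cell w ↔ (wordVal w : ℝ) ≤ x * 2 ^ w.length ∧ x * 2 ^ w.length < wordVal w + 1 := by
  have : (0 : ℝ) < 2 ^ w.length := by positivity
  rw [cell, mem_Ico, div_le_iff₀ this, lt_div_iff₀ this]

theorem cell_subset_of_prefix {u w : List Bool} (h : u <+: w) : cell w ⊆ cell u := by
  obtain ⟨t, rfl⟩ := h
  induction t using List.reverseRecOn with
  | nil => simp
  | append_singleton t b ih =>
    refine Subset.trans (fun x hx => ?_) ih
    rw [← List.append_assoc] at hx
    rw [mem_cell_iff] at hx ⊢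
    rw [wordVal_append_singleton, List.length_append, List.length_singleton, pow_succ] at hx
    have h0 : (0 : ℝ) ≤ (b.toNat : ℝ) := by positivity
    have h1 : (b.toNat : ℝ) ≤ 1 := by exact_mod_cast Bool.toNat_le b
    push_cast at hx
    constructor <;> linarith [hx.1, hx.2]

theorem eq_of_mem_cell {u w : List Bool} {x : ℝ} (hl : u.length = w.length) (hu : x ∈ cell u)
    (hw : x ∈ cell w) : u = w := by
  refine word_ext hl ?_
  rw [mem_cell_iff] at hu hw
  rw [hl] at hu
  have h1 : (wordVal u : ℝ) < wordVal w + 1 := hu.1.trans_lt hw.2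
  have h2 : (wordVal w : ℝ) < wordVal u + 1 := hw.1.trans_lt hu.2
  have h1' : wordVal u < wordVal w + 1 := by exact_mod_cast h1
  have h2' : wordVal w < wordVal u + 1 := by exact_mod_cast h2
  omega

theorem prefix_of_mem_cell {u w : List Bool} {x : ℝ} (hl : u.length ≤ w.length) (hu : x ∈ cell u)
    (hw : x ∈ cell w) : u <+: w := by
  have h : w.take u.length = u := by
    refine eq_of_mem_cell (x := x) (by simpa using hl) ?_ hu
    exact cell_subset_of_prefix (List.take_prefix _ _) hw
  rw [← h]
  exact List.take_prefix _ _

theorem exists_mem_cell {x : ℝ} (hx : x ∈ Ico (0 : ℝ) 1) (n : ℕ) :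
    ∃ w : List Bool, w.length = n ∧ x ∈ cell w := by
  have hp : (0 : ℝ) < 2 ^ n := by positivity
  have h0 : 0 ≤ x * 2 ^ n := mul_nonneg hx.1 hp.le
  have hlt : ⌊x * 2 ^ n⌋₊ < 2 ^ n := by
    rw [Nat.floor_lt h0]
    push_cast
    nlinarith [hx.2]
  obtain ⟨w, hw, hv⟩ := exists_word n _ hlt
  refine ⟨w, hw, ?_⟩
  rw [mem_cell_iff, hw, hv]
  exact ⟨Nat.floor_le h0, Nat.lt_floor_add_one _⟩

theorem cell_subset_Ico (w : List Bool) : cell w ⊆ Ico (0 : ℝ) 1 := by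
  have := cell_subset_of_prefix (List.nil_prefix (l := w))
  simpa [cell] using this

theorem volume_cell_pos (w : List Bool) : 0 < (volume.restrict (Ico (0 : ℝ) 1)) (cell w) := by
  rw [Measure.restrict_apply (by unfold cell; exact measurableSet_Ico),
    inter_eq_left.mpr (cell_subset_Ico w), cell, Real.volume_Ico, ENNReal.ofReal_pos, sub_pos]
  gcongr
  linarith

theorem haar_node_sq (w : List Bool) (x : ℝ) :
    (node w).haar x ^ 2 = (cell w).indicator 1 x := by
  have hp : (0 : ℝ) < 2 ^ w.length := by positivity
  have hcell : x ∈ cell w ↔ x ∈ (node w).leftHalf ∨ x ∈ (node w).rightHalf := by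
    simp only [mem_cell_iff, leftHalf, rightHalf, node, mem_Ico, div_le_iff₀ hp, lt_div_iff₀ hp]
    constructor
    · rintro ⟨h1, h2⟩
      rcases lt_or_ge (x * 2 ^ w.length) (wordVal w + 1 / 2) with h | h
      · exact Or.inl ⟨h1, h⟩
      · exact Or.inr ⟨h, h2⟩
    · rintro (⟨h1, h2⟩ | ⟨h1, h2⟩) <;> constructor <;> linarith
  have hdisj : x ∈ (node w).leftHalf → x ∉ (node w).rightHalf :=
    fun h1 h2 => absurd h1.2 (not_lt.mpr h2.1)
  unfold haar
  by_cases h1 : x ∈ (node w).leftHalf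
  · simp [hcell, h1, hdisj h1]
  · by_cases h2 : x ∈ (node w).rightHalf <;> simp [hcell, h1, h2]

/-! ### The norm of `SL^∞` as a supremum over branches -/

/-- The sum of the squares of the coefficients along the branch from the root to `w`. -/
def pathSum (c : List Bool → ℝ) (w : List Bool) : ℝ := ∑ u ∈ w.inits.toFinset, c u ^ 2

theorem mem_inits_toFinset {u w : List Bool} : u ∈ w.inits.toFinset ↔ u <+: w := by simp

/-- The coefficient of a Haar series at the dyadic interval attached to a word. -/
def HaarSeries.wordCoeff (a : HaarSeries) (w : List Bool) : ℝ := a (node w)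

/-- All dyadic intervals have positive measure, and finite partial sums of the square function are
constant on small dyadic intervals, so the essential supremum is a supremum over branches. -/
theorem HaarSeries.slNorm_le_iff (a : HaarSeries) {C : ℝ} (hC : 0 ≤ C) :
    a.slNorm ≤ ENNReal.ofReal C ↔ ∀ w, pathSum a.wordCoeff w ≤ C ^ 2 := by
  have hC2 : ENNReal.ofReal C ^ (2 : ℝ) = ENNReal.ofReal (C ^ 2) := by
    rw [ENNReal.ofReal_rpow_of_nonneg hC (by norm_num)]
    norm_num
  constructor
  · intro h w
    have hae : ∀ᵐ x ∂(volume.restrict (Ico (0 : ℝ) 1)),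
        a.squareFunction x ≤ ENNReal.ofReal C := by
      filter_upwards [ENNReal.ae_le_essSup a.squareFunction] with x hx
      exact hx.trans h
    obtain ⟨x, hxw, hx⟩ : ∃ x ∈ cell w, a.squareFunction x ≤ ENNReal.ofReal C := by
      by_contra! hcon
      refine (volume_cell_pos w).ne' (measure_mono_null (fun x hx => ?_) (ae_iff.mp hae))
      exact not_le.mpr (hcon x hx)
    have h1 := (squareFunction_le_iff a x _).mp hx (w.inits.toFinset.map nodeEquiv.toEmbedding)
    rw [Finset.sum_map, hC2, ← ENNReal.ofReal_sum_of_nonneg (fun _ _ => by positivity),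
      ENNReal.ofReal_le_ofReal_iff (by positivity)] at h1
    refine le_trans (le_of_eq (Finset.sum_congr rfl fun u hu => ?_)) h1
    have hxu := cell_subset_of_prefix (mem_inits_toFinset.mp hu) hxw
    change _ = a (node u) ^ 2 * (node u).haar x ^ 2
    rw [haar_node_sq, indicator_of_mem hxu]
    simp [wordCoeff]
  · intro h
    refine essSup_le_of_ae_le _ ?_
    filter_upwards [ae_restrict_mem measurableSet_Ico] with x hx
    rw [squareFunction_le_iff]
    intro F
    obtain ⟨w, hw, hxw⟩ := exists_mem_cell hx (F.sup Sigma.fst)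
    rw [hC2, ← ENNReal.ofReal_sum_of_nonneg (fun _ _ => by positivity)]
    refine ENNReal.ofReal_le_ofReal (le_trans ?_ (h w))
    have hmap : pathSum a.wordCoeff w =
        ∑ I ∈ w.inits.toFinset.map nodeEquiv.toEmbedding, a I ^ 2 := by
      rw [Finset.sum_map]
      rfl
    rw [hmap, ← Finset.sum_filter_add_sum_filter_not F (fun I => I.haar x ^ 2 = 0),
      Finset.sum_eq_zero (fun I hI => by rw [(Finset.mem_filter.mp hI).2, mul_zero]), zero_add]
    refine (Finset.sum_le_sum fun I _ =>
      mul_le_of_le_one_right (sq_nonneg _) (haar_sq_le_one I x)).trans ?_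
    refine Finset.sum_le_sum_of_subset_of_nonneg (fun I hI => ?_) (fun _ _ _ => sq_nonneg _)
    obtain ⟨hIF, hI⟩ := Finset.mem_filter.mp hI
    obtain ⟨u, rfl⟩ := node_surjective I
    have hxu : x ∈ cell u := by
      by_contra hxu
      exact hI (by rw [haar_node_sq, indicator_of_notMem hxu])
    refine Finset.mem_map.mpr ⟨u, mem_inits_toFinset.mpr (prefix_of_mem_cell ?_ hxu hxw), rfl⟩
    rw [hw]
    exact Finset.le_sup (f := Sigma.fst) hIF

namespace SLInfty

/-- The coefficients of an element of `SL^∞`, indexed by words. -/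
def wordCoeffₗ : SLInfty →ₗ[ℝ] (List Bool → ℝ) where
  toFun f := (f : HaarSeries).wordCoeff
  map_add' _ _ := rfl
  map_smul' _ _ := rfl

theorem wordCoeffₗ_apply (f : SLInfty) (w : List Bool) :
    wordCoeffₗ f w = (f : HaarSeries) (node w) := rfl

theorem wordCoeffₗ_injective : Function.Injective wordCoeffₗ := by
  intro f g h
  apply Subtype.ext
  ext I
  obtain ⟨w, rfl⟩ := node_surjective I
  exact congrFun h w

theorem ext_coeff {f g : SLInfty} (h : ∀ w, wordCoeffₗ f w = wordCoeffₗ g w) : f = g :=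
  wordCoeffₗ_injective (funext h)

theorem norm_le_iff {f : SLInfty} {C : ℝ} (hC : 0 ≤ C) :
    ‖f‖ ≤ C ↔ ∀ w, pathSum (wordCoeffₗ f) w ≤ C ^ 2 := by
  rw [← ENNReal.ofReal_le_ofReal_iff hC, ofReal_norm, HaarSeries.slNorm_le_iff _ hC]
  rfl

theorem pathSum_le (f : SLInfty) (w : List Bool) : pathSum (wordCoeffₗ f) w ≤ ‖f‖ ^ 2 :=
  (norm_le_iff (norm_nonneg f)).mp le_rfl w

theorem sum_sq_le_of_chain (f : SLInfty) {s : Finset (List Bool)} {w : List Bool}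
    (hs : ∀ u ∈ s, u <+: w) : ∑ u ∈ s, wordCoeffₗ f u ^ 2 ≤ ‖f‖ ^ 2 :=
  (Finset.sum_le_sum_of_subset_of_nonneg (fun u hu => mem_inits_toFinset.mpr (hs u hu))
    (fun _ _ _ => sq_nonneg _)).trans (pathSum_le f w)

theorem abs_wordCoeff_le (f : SLInfty) (w : List Bool) : |wordCoeffₗ f w| ≤ ‖f‖ :=
  abs_coeff_le_norm f (node w)

/-- The element of `SL^∞` with given coefficients. -/
noncomputable def ofWordCoeff (c : List Bool → ℝ) (C : ℝ) (hc : ∀ w, pathSum c w ≤ C ^ 2) :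
    SLInfty :=
  ⟨HaarSeries.ofCoeff (c ∘ nodeEquiv.symm), by
    refine lt_of_le_of_lt ((HaarSeries.slNorm_le_iff _ (abs_nonneg C)).mpr fun w => ?_)
      ENNReal.ofReal_lt_top
    rw [sq_abs]
    convert hc w using 2
    funext u
    simp [HaarSeries.wordCoeff, show node u = nodeEquiv u from rfl]⟩

@[simp] theorem wordCoeff_ofWordCoeff (c : List Bool → ℝ) (C : ℝ)
    (hc : ∀ w, pathSum c w ≤ C ^ 2) (w : List Bool) : wordCoeffₗ (ofWordCoeff c C hc) w = c w := by
  simp [wordCoeffₗ_apply, ofWordCoeff, show node w = nodeEquiv w from rfl]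

theorem norm_ofWordCoeff_le (c : List Bool → ℝ) {C : ℝ} (hC : 0 ≤ C)
    (hc : ∀ w, pathSum c w ≤ C ^ 2) : ‖ofWordCoeff c C hc‖ ≤ C := by
  rw [norm_le_iff hC]
  intro w
  convert hc w using 2
  funext u
  simp

/-- The Haar function attached to a word. -/
noncomputable def wordHaar (w : List Bool) : SLInfty := haarVec (node w)

theorem wordCoeff_wordHaar (u w : List Bool) :
    wordCoeffₗ (wordHaar u) w = if w = u then 1 else 0 := by
  classical
  simp [wordCoeffₗ_apply, wordHaar, haarVec, HaarSeries.single, Pi.single_apply,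
    node_injective.eq_iff]

theorem wordCoeff_sum_smul_wordHaar (s : Finset (List Bool)) (a : List Bool → ℝ)
    (w : List Bool) :
    wordCoeffₗ (∑ u ∈ s, a u • wordHaar u) w = if w ∈ s then a w else 0 := by
  simp [map_sum, Finset.sum_apply, wordCoeff_wordHaar]

theorem norm_wordHaar_le (w : List Bool) : ‖wordHaar w‖ ≤ 1 := by
  rw [← ENNReal.ofReal_le_ofReal_iff zero_le_one, ofReal_norm, ENNReal.ofReal_one]
  exact HaarSeries.slNorm_single_le _

/-- The norm of `SL^∞` is at most the `ℓ²` norm of the coefficients. -/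
theorem norm_sum_smul_wordHaar_le (s : Finset (List Bool)) (a : List Bool → ℝ) :
    ‖∑ u ∈ s, a u • wordHaar u‖ ≤ √(∑ u ∈ s, a u ^ 2) := by
  rw [norm_le_iff (Real.sqrt_nonneg _)]
  intro w
  rw [Real.sq_sqrt (Finset.sum_nonneg fun _ _ => sq_nonneg _), pathSum]
  simp only [wordCoeff_sum_smul_wordHaar]
  rw [← Finset.sum_filter_add_sum_filter_not _ (fun u => u ∈ s),
    Finset.sum_eq_zero (s := Finset.filter (fun u => ¬ u ∈ s) _) (fun u hu => by
      simp [(Finset.mem_filter.mp hu).2]), add_zero]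
  refine (Finset.sum_congr rfl fun u hu => ?_).trans_le
    (Finset.sum_le_sum_of_subset_of_nonneg (s := Finset.filter (fun u => u ∈ s) w.inits.toFinset)
      (f := fun u => a u ^ 2) (fun u hu => (Finset.mem_filter.mp hu).2)
      (fun _ _ _ => sq_nonneg _))
  rw [if_pos (Finset.mem_filter.mp hu).2]

/-- A partial map of words is strictly monotone for the prefix order. -/
def StrictMonoWord (g : List Bool → Option (List Bool)) : Prop :=
  ∀ u v a b, u <+: v → u ≠ v → g u = some a → g v = some b → a <+: b ∧ a ≠ b

/-- Pulling back coefficients along a strictly monotone partial map of words (and setting them to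
zero where the map is undefined) does not increase branch sums. -/
theorem pathSum_pull_le {g : List Bool → Option (List Bool)} (hg : StrictMonoWord g)
    (f : SLInfty) (w : List Bool) :
    pathSum (fun u => (g u).elim 0 (wordCoeffₗ f)) w ≤ ‖f‖ ^ 2 := by
  classical
  set s := w.inits.toFinset.filter (fun u => (g u).isSome) with hs
  have hsw : ∀ u ∈ s, u <+: w := fun u hu => mem_inits_toFinset.mp (Finset.mem_filter.mp hu).1
  have hsum : pathSum (fun u => (g u).elim 0 (wordCoeffₗ f)) w =
      ∑ u ∈ s, (g u).elim 0 (wordCoeffₗ f) ^ 2 := by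
    rw [pathSum, hs, Finset.sum_filter_of_ne]
    intro u _ hu
    cases h : g u <;> simp_all
  rw [hsum]
  rcases s.eq_empty_or_nonempty with hemp | hne
  · rw [hemp, Finset.sum_empty]
    positivity
  obtain ⟨z, hz, hmax⟩ := s.exists_max_image List.length hne
  have hsome : ∀ u ∈ s, g u = some ((g u).getD []) := fun u hu => by
    obtain ⟨a, ha⟩ := Option.isSome_iff_exists.mp (Finset.mem_filter.mp hu).2
    simp [ha]
  have hinj : Set.InjOn (fun u => (g u).getD []) s := by
    intro u hu v hv huv
    by_contra hne
    rcases List.prefix_or_prefix_of_prefix (hsw u hu) (hsw v hv) with h | h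
    · exact (hg u v _ _ h hne (hsome u hu) (hsome v hv)).2 huv
    · exact (hg v u _ _ h (Ne.symm hne) (hsome v hv) (hsome u hu)).2 huv.symm
  have heq : ∑ u ∈ s, (g u).elim 0 (wordCoeffₗ f) ^ 2 =
      ∑ a ∈ s.image (fun u => (g u).getD []), wordCoeffₗ f a ^ 2 := by
    rw [Finset.sum_image hinj]
    refine Finset.sum_congr rfl fun u hu => ?_
    conv_lhs => rw [hsome u hu]
    rfl
  rw [heq]
  refine sum_sq_le_of_chain f (w := (g z).getD []) fun a ha => ?_
  obtain ⟨u, hu, rfl⟩ := Finset.mem_image.mp ha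
  by_cases huz : u = z
  · exact huz ▸ List.prefix_refl _
  · exact (hg u z _ _ (List.prefix_of_prefix_length_le (hsw u hu) (hsw z hz) (hmax u hu)) huz
      (hsome u hu) (hsome z hz)).1

theorem pathSum_mul_le {s c : List Bool → ℝ} {κ : ℝ} (hs : ∀ w, |s w| ≤ κ)
    (w : List Bool) : pathSum (fun u => s u * c u) w ≤ κ ^ 2 * pathSum c w := by
  rw [pathSum, pathSum, Finset.mul_sum]
  refine Finset.sum_le_sum fun u _ => ?_
  rw [mul_pow]
  exact mul_le_mul_of_nonneg_right (sq_le_sq' (abs_le.mp (hs u)).1 (abs_le.mp (hs u)).2)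
    (sq_nonneg _)

theorem pathSum_mul_pull_le {g : List Bool → Option (List Bool)} (hg : StrictMonoWord g)
    {s : List Bool → ℝ} {κ : ℝ} (hs : ∀ w, |s w| ≤ κ) (f : SLInfty) (w : List Bool) :
    pathSum (fun w => s w * (g w).elim 0 (wordCoeffₗ f)) w ≤ (κ * ‖f‖) ^ 2 := by
  rw [mul_pow]
  exact (pathSum_mul_le hs w).trans
    (mul_le_mul_of_nonneg_left (pathSum_pull_le hg f w) (sq_nonneg _))

/-- The operator on `SL^∞` pulling back coefficients along a strictly monotone partial map `g` of
words and multiplying them by the bounded weights `s`. -/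
noncomputable def pull (g : List Bool → Option (List Bool)) (hg : StrictMonoWord g)
    (s : List Bool → ℝ) (κ : ℝ) (hs : ∀ w, |s w| ≤ κ) : SLInfty →L[ℝ] SLInfty :=
  LinearMap.mkContinuous
    { toFun := fun f => ofWordCoeff (fun w => s w * (g w).elim 0 (wordCoeffₗ f)) (κ * ‖f‖)
        (pathSum_mul_pull_le hg hs f)
      map_add' := fun f₁ f₂ => ext_coeff fun w => by
        cases h : g w <;> simp [h, mul_add]
      map_smul' := fun c f => ext_coeff fun w => by
        cases h : g w <;> simp [h]
        ring }
    κ fun f => norm_ofWordCoeff_le _ (mul_nonneg ((abs_nonneg _).trans (hs [])) (norm_nonneg f))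
      (pathSum_mul_pull_le hg hs f)

@[simp] theorem wordCoeff_pull (g : List Bool → Option (List Bool)) (hg : StrictMonoWord g)
    (s : List Bool → ℝ) (κ : ℝ) (hs : ∀ w, |s w| ≤ κ) (f : SLInfty) (w : List Bool) :
    wordCoeffₗ (pull g hg s κ hs f) w = s w * (g w).elim 0 (wordCoeffₗ f) := by
  simp [pull]

theorem norm_pull_apply_le (g : List Bool → Option (List Bool)) (hg : StrictMonoWord g)
    (s : List Bool → ℝ) (κ : ℝ) (hs : ∀ w, |s w| ≤ κ) (f : SLInfty) :
    ‖pull g hg s κ hs f‖ ≤ κ * ‖f‖ :=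
  ContinuousLinearMap.le_of_opNorm_le _
    (LinearMap.mkContinuous_norm_le _ ((abs_nonneg _).trans (hs [])) _) f

end SLInfty

/-! ### The spaces `SL^∞_n` -/

open SLInfty

theorem mem_SLInftyFin_iff {n : ℕ} {f : SLInfty} :
    f ∈ SLInftyFin n ↔ ∀ w : List Bool, n < w.length → wordCoeffₗ f w = 0 := by
  constructor
  · intro hf w hw
    induction hf using Submodule.span_induction with
    | mem f hf =>
      obtain ⟨I, hI, rfl⟩ := hf
      obtain ⟨u, rfl⟩ := node_surjective I
      change wordCoeffₗ (wordHaar u) w = 0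
      rw [wordCoeff_wordHaar, if_neg]
      rintro rfl
      exact absurd hI (not_le.mpr hw)
    | zero => simp
    | add f g _ _ hf hg => simp [hf, hg]
    | smul c f _ hf => simp [hf]
  · intro hf
    have : f = ∑ u ∈ shortWords (n + 1), wordCoeffₗ f u • wordHaar u := by
      refine ext_coeff fun w => ?_
      rw [wordCoeff_sum_smul_wordHaar]
      split_ifs with h
      · rfl
      · exact hf w (by simpa [Nat.lt_succ_iff] using h)
    rw [this]
    refine Submodule.sum_mem _ fun u hu => Submodule.smul_mem _ _ (Submodule.subset_span ?_)
    exact ⟨node u, Nat.lt_succ_iff.mp (mem_shortWords.mp hu), rfl⟩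

theorem sum_wordCoeff_smul_wordHaar {n : ℕ} {f : SLInfty} (hf : f ∈ SLInftyFin n) :
    ∑ u ∈ shortWords (n + 1), wordCoeffₗ f u • wordHaar u = f := by
  refine ext_coeff fun w => ?_
  rw [wordCoeff_sum_smul_wordHaar]
  split_ifs with h
  · rfl
  · exact (mem_SLInftyFin_iff.mp hf w (by simpa [Nat.lt_succ_iff] using h)).symm

theorem wordHaar_mem {n : ℕ} {w : List Bool} (hw : w.length ≤ n) : wordHaar w ∈ SLInftyFin n :=
  Submodule.subset_span ⟨node w, hw, rfl⟩

theorem norm_le_card_mul {n : ℕ} {f : SLInfty} (hf : f ∈ SLInftyFin n) {C : ℝ}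
    (hC : ∀ w : List Bool, w.length < n + 1 → |wordCoeffₗ f w| ≤ C) :
    ‖f‖ ≤ (shortWords (n + 1)).card * C := by
  rw [← sum_wordCoeff_smul_wordHaar hf, ← nsmul_eq_mul]
  refine (norm_sum_le _ _).trans (Finset.sum_le_card_nsmul _ _ _ fun u hu => ?_)
  rw [norm_smul, Real.norm_eq_abs]
  exact (mul_le_of_le_one_right (abs_nonneg _) (norm_wordHaar_le u)).trans
    (hC u (mem_shortWords.mp hu))

/-! ### Operators into `ℓ^p`-sums -/

section LpBound

variable {ι : Type*} {F : ι → Type*} [∀ i, NormedAddCommGroup (F i)] {p : ℝ≥0∞}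

/-- The family `y` has `ℓ^p` norm at most `C`, expressed without suprema and infinite sums. -/
def LpBound (p : ℝ≥0∞) (y : ∀ i, F i) (C : ℝ) : Prop :=
  (p = ∞ → ∀ i, ‖y i‖ ≤ C) ∧
    (p ≠ ∞ → ∀ s : Finset ι, ∑ i ∈ s, ‖y i‖ ^ p.toReal ≤ C ^ p.toReal)

theorem toReal_pos_of_ne_top (p : ℝ≥0∞) [Fact (1 ≤ p)] (hp : p ≠ ∞) : 0 < p.toReal :=
  ENNReal.toReal_pos (zero_lt_one.trans_le Fact.out).ne' hp

theorem LpBound.memℓp {y : ∀ i, F i} {C : ℝ} (h : LpBound p y C) : Memℓp y p := by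
  by_cases hp : p = ∞
  · subst hp
    exact memℓp_infty ⟨C, by rintro _ ⟨i, rfl⟩; exact h.1 rfl i⟩
  · exact memℓp_gen' (h.2 hp)

theorem LpBound.norm_le [Fact (1 ≤ p)] {y : lp F p} {C : ℝ} (hC : 0 ≤ C)
    (h : LpBound p (fun i => y i) C) : ‖y‖ ≤ C := by
  by_cases hp : p = ∞
  · subst hp
    exact lp.norm_le_of_forall_le hC (h.1 rfl)
  · exact lp.norm_le_of_forall_sum_le (toReal_pos_of_ne_top p hp) hC (h.2 hp)

theorem lpBound_norm [Fact (1 ≤ p)] (y : lp F p) : LpBound p (fun i => y i) ‖y‖ :=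
  ⟨fun _ i => lp.norm_apply_le_norm (zero_lt_one.trans_le Fact.out).ne' y i,
    fun hp s => lp.sum_rpow_le_norm_rpow (toReal_pos_of_ne_top p hp) y s⟩

theorem sum_option_elim {κ : Type*} [DecidableEq κ] (t : Finset (Option κ)) (N : κ → ℝ) :
    ∑ o ∈ t, o.elim 0 N = ∑ j ∈ Finset.eraseNone t, N j := by
  have h := Finset.sum_map (Finset.eraseNone t) Function.Embedding.some (fun o => o.elim 0 N)
  rw [Finset.map_some_eraseNone, 
    Finset.sum_erase t (f := fun o => o.elim 0 N) (a := none) rfl] at h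
  exact h

/-- Rearranging, omitting and rescaling coordinates by `C` increases the `ℓ^p` norm by a factor of
at most `C`. -/
theorem LpBound.of_le_comp [Fact (1 ≤ p)] {κ : Type*} {E : κ → Type*}
    [∀ j, NormedAddCommGroup (E j)] (x : lp E p) {y : ∀ i, F i} {C : ℝ} (hC : 0 ≤ C)
    (g : ι → Option κ) (hg : ∀ i i' j, g i = some j → g i' = some j → i = i')
    (h : ∀ i, ‖y i‖ ≤ C * (g i).elim 0 (fun j => ‖x j‖)) : LpBound p y (C * ‖x‖) := by
  classical
  refine ⟨fun hp i => (h i).trans (mul_le_mul_of_nonneg_left ?_ hC), fun hp s => ?_⟩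
  · cases g i with
    | none => exact norm_nonneg x
    | some j => exact lp.norm_apply_le_norm (zero_lt_one.trans_le Fact.out).ne' x j
  · have hp0 := toReal_pos_of_ne_top p hp
    rw [Real.mul_rpow hC (norm_nonneg x)]
    have hinj : Set.InjOn g (s.filter fun i => (g i).isSome) := by
      intro i hi i' _ hii'
      obtain ⟨j, hj⟩ := Option.isSome_iff_exists.mp (Finset.mem_filter.mp hi).2
      exact hg i i' j hj (hii' ▸ hj)
    have key : ∀ o : Option κ, (o.elim 0 (fun j => ‖x j‖)) ^ p.toReal =
        o.elim 0 (fun j => ‖x j‖ ^ p.toReal) := by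
      rintro (_ | j)
      · exact Real.zero_rpow hp0.ne'
      · rfl
    calc ∑ i ∈ s, ‖y i‖ ^ p.toReal
        ≤ ∑ i ∈ s, C ^ p.toReal * (g i).elim 0 (fun j => ‖x j‖ ^ p.toReal) := by
          refine Finset.sum_le_sum fun i _ => ?_
          refine (Real.rpow_le_rpow (norm_nonneg _) (h i) hp0.le).trans_eq ?_
          rw [Real.mul_rpow hC, key]
          cases g i <;> simp
      _ = C ^ p.toReal * ∑ i ∈ s.filter (fun i => (g i).isSome),
            (g i).elim 0 (fun j => ‖x j‖ ^ p.toReal) := by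
          rw [← Finset.mul_sum, Finset.sum_filter_of_ne]
          intro i _ hi
          cases h' : g i <;> simp_all
      _ = C ^ p.toReal * ∑ o ∈ (s.filter (fun i => (g i).isSome)).image g,
            o.elim 0 (fun j => ‖x j‖ ^ p.toReal) := by
          rw [Finset.sum_image hinj]
      _ = C ^ p.toReal * ∑ j ∈ Finset.eraseNone ((s.filter (fun i => (g i).isSome)).image g),
            ‖x j‖ ^ p.toReal := by
          rw [sum_option_elim]
      _ ≤ C ^ p.toReal * ‖x‖ ^ p.toReal :=
          mul_le_mul_of_nonneg_left (lp.sum_rpow_le_norm_rpow hp0 x _)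
            (Real.rpow_nonneg hC _)

/-- The `ℓ^p` norm is at most the `ℓ^1` norm. -/
theorem LpBound.of_sum_le [Fact (1 ≤ p)] [DecidableEq ι] {y : ∀ i, F i} {C : ℝ}
    (h : ∀ s : Finset ι, ∑ i ∈ s, ‖y i‖ ≤ C) : LpBound p y C := by
  refine ⟨fun _ i => by simpa using h {i}, fun hp s => ?_⟩
  have hp0 := toReal_pos_of_ne_top p hp
  rw [← lp.norm_sum_single hp0 y s]
  refine Real.rpow_le_rpow (norm_nonneg _) ((norm_sum_le _ _).trans ?_) hp0.le
  simpa only [lp.norm_single (zero_lt_one.trans_le (Fact.out : 1 ≤ p))] using h s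

variable [∀ i, NormedSpace ℝ (F i)] {V : Type*} [NormedAddCommGroup V] [NormedSpace ℝ V]

/-- The operator into an `ℓ^p`-sum with given components. -/
noncomputable def lpOfComponents [Fact (1 ≤ p)] (L : ∀ i, V →ₗ[ℝ] F i) (C : ℝ) (hC : 0 ≤ C)
    (h : ∀ x, LpBound p (fun i => L i x) (C * ‖x‖)) : V →L[ℝ] lp F p :=
  LinearMap.mkContinuous
    { toFun := fun x => ⟨fun i => L i x, (h x).memℓp⟩
      map_add' := fun x y => lp.ext (funext fun i => map_add (L i) x y)
      map_smul' := fun c x => lp.ext (funext fun i => map_smul (L i) c x) }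
    C fun x => LpBound.norm_le (mul_nonneg hC (norm_nonneg x)) (h x)

@[simp] theorem lpOfComponents_apply [Fact (1 ≤ p)] (L : ∀ i, V →ₗ[ℝ] F i) (C : ℝ) (hC : 0 ≤ C)
    (h : ∀ x, LpBound p (fun i => L i x) (C * ‖x‖)) (x : V) (i : ι) :
    lpOfComponents L C hC h x i = L i x := rfl

theorem norm_lpOfComponents_le [Fact (1 ≤ p)] (L : ∀ i, V →ₗ[ℝ] F i) (C : ℝ) (hC : 0 ≤ C)
    (h : ∀ x, LpBound p (fun i => L i x) (C * ‖x‖)) : ‖lpOfComponents L C hC h‖ ≤ C :=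
  LinearMap.mkContinuous_norm_le _ hC _

end LpBound

/-! ### Complemented subspaces and the decomposition method -/

section Factors

variable {A B D : Type*} [NormedAddCommGroup A] [NormedSpace ℝ A] [NormedAddCommGroup B]
  [NormedSpace ℝ B] [NormedAddCommGroup D] [NormedSpace ℝ D]

/-- The identity of `A` factors through `B`, that is, `A` is isomorphic to a complemented subspace
of `B`. -/
def IdFactorsThrough (A B : Type*) [NormedAddCommGroup A] [NormedSpace ℝ A]
    [NormedAddCommGroup B] [NormedSpace ℝ B] : Prop :=
  ∃ (R : A →L[ℝ] B) (S : B →L[ℝ] A), ∀ x, S (R x) = x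

theorem IdFactorsThrough.trans (h₁ : IdFactorsThrough A B) (h₂ : IdFactorsThrough B D) :
    IdFactorsThrough A D := by
  obtain ⟨R₁, S₁, h₁⟩ := h₁
  obtain ⟨R₂, S₂, h₂⟩ := h₂
  exact ⟨R₂ ∘L R₁, S₁ ∘L S₂, fun x => by simp [h₁, h₂]⟩

theorem ContinuousLinearEquiv.idFactorsThrough (e : A ≃L[ℝ] B) : IdFactorsThrough A B :=
  ⟨e, e.symm, fun x => by simp⟩

theorem idFactorsThrough_prod_right : IdFactorsThrough B (A × B) :=
  ⟨ContinuousLinearMap.inr ℝ A B, ContinuousLinearMap.snd ℝ A B, fun _ => rfl⟩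

/-- A complemented subspace has a closed complement. -/
theorem IdFactorsThrough.exists_complement (h : IdFactorsThrough A B) :
    ∃ K : Submodule ℝ B, IdFactorsThrough K B ∧ Nonempty (B ≃L[ℝ] A × K) := by
  obtain ⟨R, S, h⟩ := h
  let e := ContinuousLinearEquiv.equivOfRightInverse S R h
  exact ⟨_, idFactorsThrough_prod_right.trans e.symm.idFactorsThrough, ⟨e⟩⟩

variable (p : ℝ≥0∞) [Fact (1 ≤ p)]

/-- The operator on `ℓ^p(A)` acting as `P` on each coordinate. -/
noncomputable def lpAmplify (P : A →L[ℝ] A) : lp (fun _ : ℕ => A) p →L[ℝ] lp (fun _ : ℕ => A) p :=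
  lpOfComponents (fun i => (P ∘L lp.evalCLM ℝ _ p i : _ →L[ℝ] A).toLinearMap) ‖P‖ (norm_nonneg P)
    fun x => LpBound.of_le_comp x (norm_nonneg P) some (by simp) fun i => P.le_opNorm (x i)

/-- The right shift on `ℓ^p(A)`. -/
noncomputable def lpShiftRight : lp (fun _ : ℕ => A) p →L[ℝ] lp (fun _ : ℕ => A) p :=
  lpOfComponents (fun i => i.casesOn (0 : _ →ₗ[ℝ] A)
      fun i => (lp.evalCLM ℝ (fun _ : ℕ => A) p i : _ →L[ℝ] A).toLinearMap) 1 zero_le_one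
    fun x => LpBound.of_le_comp x zero_le_one (fun i => i.casesOn none some)
      (by rintro (_ | i) (_ | i') j <;> simp; omega)
      fun i => by
        cases i with
        | zero => simp
        | succ i => exact (one_mul _).ge

/-- The left shift on `ℓ^p(A)`. -/
noncomputable def lpShiftLeft : lp (fun _ : ℕ => A) p →L[ℝ] lp (fun _ : ℕ => A) p :=
  lpOfComponents (fun i => (lp.evalCLM ℝ (fun _ : ℕ => A) p (i + 1) : _ →L[ℝ] A).toLinearMap)
    1 zero_le_one
    fun x => LpBound.of_le_comp x zero_le_one (fun i => some (i + 1))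
      (fun i i' j h h' => by simp at h h'; omega)
      fun _ => (one_mul _).ge

/-- The space `ℓ^p(A)` absorbs every complemented subspace of `A`: with `P` the projection onto
the subspace, shift the `P`-parts of all coordinates by one and insert the new vector into the
vacant place. -/
theorem IdFactorsThrough.nonempty_equiv_prod_lp (h : IdFactorsThrough B A) :
    Nonempty (lp (fun _ : ℕ => A) p ≃L[ℝ] B × lp (fun _ : ℕ => A) p) := by
  obtain ⟨R, S, hSR⟩ := h
  let E := lp (fun _ : ℕ => A) p
  let Q : E →L[ℝ] E := lpAmplify p (R ∘L S)
  let Ψ : E →L[ℝ] B × E := (S ∘L lp.evalCLM ℝ (fun _ : ℕ => A) p 0).prod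
    (Q ∘L lpShiftLeft p + (ContinuousLinearMap.id ℝ E - Q))
  let Φ : B × E →L[ℝ] E := (lp.singleContinuousLinearMap ℝ (fun _ : ℕ => A) p 0 ∘L R).coprod
    (lpShiftRight p ∘L Q + (ContinuousLinearMap.id ℝ E - Q))
  have hΨ1 : ∀ w, (Ψ w).1 = S (w 0) := fun w => rfl
  have hΨ2 : ∀ w i, (Ψ w).2 i = R (S (w (i + 1))) + (w i - R (S (w i))) := fun w i => rfl
  have hΦ0 : ∀ z, Φ z 0 = R z.1 + (z.2 0 - R (S (z.2 0))) := fun z => by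
    have : Φ z 0 = R z.1 + (0 + (z.2 0 - R (S (z.2 0)))) := rfl
    rw [this, zero_add]
  have hΦs : ∀ z i, Φ z (i + 1) = R (S (z.2 i)) + (z.2 (i + 1) - R (S (z.2 (i + 1)))) :=
    fun z i => by
    have : Φ z (i + 1) = 0 + (R (S (z.2 i)) + (z.2 (i + 1) - R (S (z.2 (i + 1))))) := rfl
    rw [this, zero_add]
  refine ⟨ContinuousLinearEquiv.equivOfInverse Ψ Φ (fun w => ?_) (fun z => ?_)⟩
  · refine lp.ext (funext fun i => ?_)
    cases i with
    | zero => simp [hΦ0, hΨ1, hΨ2, hSR]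
    | succ i => simp [hΦs, hΨ2, hSR]
  · refine Prod.ext ?_ (lp.ext (funext fun i => ?_))
    · simp [hΨ1, hΦ0, hSR]
    · cases i with
      | zero => simp [hΨ2, hΦ0, hΦs, hSR]
      | succ i => simp [hΨ2, hΦs, hSR]

/-- Pełczyński's decomposition method. -/
theorem IdFactorsThrough.nonempty_equiv_lp (h₁ : IdFactorsThrough B A)
    (h₂ : IdFactorsThrough (lp (fun _ : ℕ => A) p) B) :
    Nonempty (B ≃L[ℝ] lp (fun _ : ℕ => A) p) := by
  obtain ⟨K, hK, ⟨e⟩⟩ := h₂.exists_complement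
  obtain ⟨e'⟩ := (hK.trans h₁).nonempty_equiv_prod_lp p
  exact ⟨e.trans ((ContinuousLinearEquiv.prodComm ℝ _ _).trans e'.symm)⟩

/-- Let `A` contain a complemented copy of `ℓ^p(A)`. If for every operator `T` on `A` the identity
of `A` factors through `T` or through `Id - T`, then all spaces isomorphic to `A` are primary. -/
theorem isPrimaryBanach_of_factorization [CompleteSpace B] (e : B ≃L[ℝ] A)
    (hA : IdFactorsThrough (lp (fun _ : ℕ => A) p) A)
    (hT : ∀ T : A →L[ℝ] A, ∃ R S H : A →L[ℝ] A,
      (H = T ∨ H = ContinuousLinearMap.id ℝ A - T) ∧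
        S ∘L H ∘L R = ContinuousLinearMap.id ℝ A) : IsPrimaryBanach B := by
  intro Q hQ
  have hQQ : ∀ x, Q (Q x) = Q x := fun x => DFunLike.congr_fun hQ x
  obtain ⟨eB⟩ := (e.idFactorsThrough).nonempty_equiv_lp p (hA.trans e.symm.idFactorsThrough)
  have key : ∀ (H' : B →L[ℝ] B) (R S : A →L[ℝ] A), (∀ x, H' (H' x) = H' x) →
      (∀ x, S (e (H' (e.symm (R x)))) = x) →
      Nonempty (LinearMap.range (H' : B →ₗ[ℝ] B) ≃L[ℝ] B) := by
    intro H' R S hH hS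
    have h₁ : IdFactorsThrough (LinearMap.range (H' : B →ₗ[ℝ] B)) B := by
      refine ⟨Submodule.subtypeL _, H'.codRestrict _ fun x => ⟨x, rfl⟩, ?_⟩
      rintro ⟨_, x, rfl⟩
      exact Subtype.ext (hH x)
    have h₂ : IdFactorsThrough A (LinearMap.range (H' : B →ₗ[ℝ] B)) :=
      ⟨(H' ∘L (e.symm : A →L[ℝ] B) ∘L R).codRestrict _ fun x => ⟨e.symm (R x), rfl⟩,
        S ∘L (e : B →L[ℝ] A) ∘L Submodule.subtypeL _, hS⟩
    obtain ⟨eH⟩ := (h₁.trans e.idFactorsThrough).nonempty_equiv_lp p (hA.trans h₂)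
    exact ⟨eH.trans eB.symm⟩
  obtain ⟨R, S, H, hH, hS⟩ := hT ((e : B →L[ℝ] A) ∘L Q ∘L (e.symm : A →L[ℝ] B))
  have hS' : ∀ x, S (H (R x)) = x := fun x => DFunLike.congr_fun hS x
  rcases hH with rfl | rfl
  · exact Or.inl (key Q R S hQQ hS')
  · refine Or.inr (key (ContinuousLinearMap.id ℝ B - Q) R S (fun x => by simp [hQQ]) fun x => ?_)
    have := hS' x
    simpa using this

end Factors

/-! ### Complemented subspaces of `X^{(r)}` and of `SL^∞` -/

namespace SLInfty

/-- The operator `SL^∞ → SL^∞_n` pulling back coefficients along a strictly monotone partial map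
of words and truncating at level `n`. -/
noncomputable def pullFin (n : ℕ) (g : List Bool → Option (List Bool)) (hg : StrictMonoWord g) :
    SLInfty →L[ℝ] SLInftyFin n :=
  (pull g hg (fun w => if w.length ≤ n then 1 else 0) 1
    (fun w => by split_ifs <;> simp)).codRestrict (SLInftyFin n) fun f =>
      mem_SLInftyFin_iff.mpr fun w hw => by simp [not_le.mpr hw]

@[simp] theorem wordCoeff_pullFin (n : ℕ) (g : List Bool → Option (List Bool))
    (hg : StrictMonoWord g) (f : SLInfty) (w : List Bool) :
    wordCoeffₗ (pullFin n g hg f : SLInfty) w =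
      if w.length ≤ n then (g w).elim 0 (wordCoeffₗ f) else 0 := by
  simp [pullFin]

theorem norm_pullFin_le (n : ℕ) (g : List Bool → Option (List Bool)) (hg : StrictMonoWord g)
    (f : SLInfty) : ‖pullFin n g hg f‖ ≤ ‖f‖ :=
  (norm_pull_apply_le g hg (fun w => if w.length ≤ n then 1 else 0) 1
    (fun w => by split_ifs <;> simp) f).trans_eq (one_mul _)

theorem strictMonoWord_some : StrictMonoWord some := by
  intro u v a b huv hne ha hb
  simp only [Option.some.injEq] at ha hb
  exact ⟨ha ▸ hb ▸ huv, ha ▸ hb ▸ hne⟩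

/-- The partial sum projection `SL^∞ → SL^∞_n`. -/
noncomputable def trunc (n : ℕ) : SLInfty →L[ℝ] SLInftyFin n := pullFin n some strictMonoWord_some

@[simp] theorem wordCoeff_trunc (n : ℕ) (f : SLInfty) (w : List Bool) :
    wordCoeffₗ (trunc n f : SLInfty) w = if w.length ≤ n then wordCoeffₗ f w else 0 := by
  simp [trunc]

theorem norm_trunc_le (n : ℕ) (f : SLInfty) : ‖trunc n f‖ ≤ ‖f‖ := norm_pullFin_le _ _ _ f

theorem wordCoeff_eq_zero {n : ℕ} (f : SLInftyFin n) {w : List Bool} (hw : n < w.length) :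
    wordCoeffₗ (f : SLInfty) w = 0 :=
  mem_SLInftyFin_iff.mp f.2 w hw

end SLInfty

section SLSum

theorem SLSum.ext_coeff {r : ℝ≥0∞} {x y : SLSum r}
    (h : ∀ n w, wordCoeffₗ (x n : SLInfty) w = wordCoeffₗ (y n : SLInfty) w) : x = y :=
  lp.ext (funext fun n => Subtype.ext (SLInfty.ext_coeff (h n)))

variable (r : ℝ≥0∞) [Fact (1 ≤ r)]

/-- The coordinate projection of `X^{(r)}` onto its `n`-th summand, as a map into `SL^∞`. -/
noncomputable def blockCLM (n : ℕ) : SLSum r →L[ℝ] SLInfty :=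
  (SLInftyFin n).subtypeL ∘L lp.evalCLM ℝ (fun n : ℕ => SLInftyFin n) r n

@[simp] theorem blockCLM_apply (n : ℕ) (x : SLSum r) : blockCLM r n x = (x n : SLInfty) := rfl

variable {r}

theorem norm_block_le (x : SLSum r) (n : ℕ) : ‖(x n : SLInfty)‖ ≤ ‖x‖ :=
  lp.norm_apply_le_norm (zero_lt_one.trans_le Fact.out).ne' x n

variable (r)

/-- The map from `ℓ^r(X^{(r)})` to `X^{(r)}` putting the `n`-th block of the `i`-th entry into
the block number `Nat.pair i n ≥ n`. -/
noncomputable def pairBlocks : lp (fun _ : ℕ => SLSum r) r →L[ℝ] SLSum r :=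
  lpOfComponents (fun m => (trunc m ∘L blockCLM r m.unpair.2 ∘L
    lp.evalCLM ℝ (fun _ : ℕ => SLSum r) r m.unpair.1 : _ →L[ℝ] SLInftyFin m).toLinearMap)
    1 zero_le_one fun x => by
    have hle : ∀ m : ℕ, ‖trunc m (x m.unpair.1 m.unpair.2 : SLInfty)‖ ≤
        ‖(x m.unpair.1 m.unpair.2 : SLInfty)‖ := fun m => norm_trunc_le _ _
    rw [one_mul]
    refine ⟨fun hr m => (hle m).trans ((norm_block_le _ _).trans
      ((lpBound_norm x).1 hr m.unpair.1)), fun hr s => ?_⟩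
    have hr0 := toReal_pos_of_ne_top r hr
    let I := s.image fun m => m.unpair.1
    let J := s.image fun m => m.unpair.2
    calc ∑ m ∈ s, ‖trunc m (x m.unpair.1 m.unpair.2 : SLInfty)‖ ^ r.toReal
        ≤ ∑ m ∈ s, ‖(x m.unpair.1 m.unpair.2 : SLInfty)‖ ^ r.toReal :=
          Finset.sum_le_sum fun m _ => Real.rpow_le_rpow (norm_nonneg _) (hle m) hr0.le
      _ = ∑ a ∈ s.map Nat.pairEquiv.symm.toEmbedding, ‖(x a.1 a.2 : SLInfty)‖ ^ r.toReal := by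
          rw [Finset.sum_map]
          rfl
      _ ≤ ∑ a ∈ I ×ˢ J, ‖(x a.1 a.2 : SLInfty)‖ ^ r.toReal := by
          refine Finset.sum_le_sum_of_subset_of_nonneg (fun a ha => ?_)
            (fun _ _ _ => Real.rpow_nonneg (norm_nonneg _) _)
          obtain ⟨m, hm, rfl⟩ := Finset.mem_map.mp ha
          exact Finset.mem_product.mpr
            ⟨Finset.mem_image_of_mem _ hm, Finset.mem_image_of_mem _ hm⟩
      _ = ∑ i ∈ I, ∑ n ∈ J, ‖(x i n : SLInfty)‖ ^ r.toReal := Finset.sum_product _ _ _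
      _ ≤ ∑ i ∈ I, ‖x i‖ ^ r.toReal :=
          Finset.sum_le_sum fun i _ => lp.sum_rpow_le_norm_rpow hr0 (x i) J
      _ ≤ ‖x‖ ^ r.toReal := lp.sum_rpow_le_norm_rpow hr0 x I

/-- The `i`-th component of `unpairBlocks`. -/
noncomputable def unpairBlock (i : ℕ) : SLSum r →L[ℝ] SLSum r :=
  lpOfComponents (fun n => (trunc n ∘L blockCLM r (Nat.pair i n) :
    _ →L[ℝ] SLInftyFin n).toLinearMap) 1 zero_le_one fun x =>
    LpBound.of_le_comp x zero_le_one (fun n => some (Nat.pair i n))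
      (fun n n' j h h' => by
        simp only [Option.some.injEq] at h h'
        exact (Nat.pair_eq_pair.mp (h.trans h'.symm)).2)
      fun n => by rw [one_mul]; exact norm_trunc_le _ _

/-- A left inverse of `pairBlocks`. -/
noncomputable def unpairBlocks : SLSum r →L[ℝ] lp (fun _ : ℕ => SLSum r) r :=
  lpOfComponents (fun i => (unpairBlock r i).toLinearMap) 1 zero_le_one fun x => by
    rw [one_mul]
    refine ⟨fun _ i => ?_, fun hr s => ?_⟩
    · exact (ContinuousLinearMap.le_of_opNorm_le _ (norm_lpOfComponents_le _ 1 _ _) x).trans_eq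
        (one_mul _)
    · have hr0 := toReal_pos_of_ne_top r hr
      refine hasSum_le_of_sum_le (hasSum_sum fun i (_ : i ∈ s) =>
        lp.hasSum_norm hr0 (unpairBlock r i x)) fun t => ?_
      calc ∑ n ∈ t, ∑ i ∈ s, ‖unpairBlock r i x n‖ ^ r.toReal
          ≤ ∑ n ∈ t, ∑ i ∈ s, ‖x (Nat.pair i n)‖ ^ r.toReal :=
            Finset.sum_le_sum fun n _ => Finset.sum_le_sum fun i _ =>
              Real.rpow_le_rpow (norm_nonneg _) (norm_trunc_le _ _) hr0.le
        _ = ∑ a ∈ s ×ˢ t, ‖x (Nat.pair a.1 a.2)‖ ^ r.toReal := by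
            rw [Finset.sum_comm, Finset.sum_product]
        _ = ∑ m ∈ (s ×ˢ t).map Nat.pairEquiv.toEmbedding, ‖x m‖ ^ r.toReal := by
            rw [Finset.sum_map]
            rfl
        _ ≤ ‖x‖ ^ r.toReal := lp.sum_rpow_le_norm_rpow hr0 x _

theorem idFactorsThrough_lp_SLSum : IdFactorsThrough (lp (fun _ : ℕ => SLSum r) r) (SLSum r) := by
  refine ⟨pairBlocks r, unpairBlocks r, fun x => lp.ext (funext fun i => SLSum.ext_coeff
    fun n w => ?_)⟩
  have h : ∀ m, wordCoeffₗ (pairBlocks r x m : SLInfty) w =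
      if w.length ≤ m then wordCoeffₗ (x m.unpair.1 m.unpair.2 : SLInfty) w else 0 :=
    fun m => wordCoeff_trunc _ _ _
  change wordCoeffₗ (trunc n (pairBlocks r x (Nat.pair i n) : SLInfty) : SLInfty) w = _
  rw [wordCoeff_trunc, h, Nat.unpair_pair]
  split_ifs with h1 h2
  · rfl
  · exact absurd (h1.trans (Nat.right_le_pair i n)) h2
  · exact (wordCoeff_eq_zero _ (not_le.mp h1)).symm

end SLSum

/-! ### `SL^∞` and `X^{(∞)}` are complemented in each other -/

/-- The number of leading ones of a word. -/
def leadingOnes : List Bool → ℕ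
  | true :: w => leadingOnes w + 1
  | _ => 0

/-- The partial map of words sending `1ⁿ 0 u` to `u`. -/
def stripOnes : ℕ → List Bool → Option (List Bool)
  | 0, false :: u => some u
  | n + 1, true :: w => stripOnes n w
  | _, _ => none

theorem strictMonoWord_stripOnes (n : ℕ) : StrictMonoWord (stripOnes n) := by
  induction n with
  | zero =>
    intro u v a b huv hne ha hb
    match u, v with
    | false :: u, false :: v =>
      simp only [stripOnes, Option.some.injEq] at ha hb
      subst ha hb
      exact ⟨by simpa using huv, by simpa using hne⟩
    | [], _ => simp [stripOnes] at ha
    | true :: _, _ => simp [stripOnes] at ha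
    | _, [] => simp [stripOnes] at hb
    | _, true :: _ => simp [stripOnes] at hb
  | succ n ih =>
    intro u v a b huv hne ha hb
    match u, v with
    | true :: u, true :: v =>
      exact ih u v a b (by simpa using huv) (by simpa using hne) ha hb
    | [], _ => simp [stripOnes] at ha
    | false :: _, _ => simp [stripOnes] at ha
    | _, [] => simp [stripOnes] at hb
    | _, false :: _ => simp [stripOnes] at hb

theorem leadingOnes_eq_or_stripOnes_eq_none {u w : List Bool} (h : u <+: w) :
    leadingOnes u = leadingOnes w ∨ ∀ n, stripOnes n u = none := by
  induction u generalizing w with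
  | nil => exact Or.inr fun n => by cases n <;> rfl
  | cons a u ih =>
    obtain ⟨t, rfl⟩ := h
    cases a with
    | false => exact Or.inl rfl
    | true =>
      rcases ih (w := u ++ t) (List.prefix_append _ _) with h | h
      · exact Or.inl (congrArg (· + 1) h)
      · refine Or.inr fun n => ?_
        cases n with
        | zero => rfl
        | succ n => exact h n

theorem leadingOnes_replicate (n : ℕ) (u : List Bool) :
    leadingOnes (List.replicate n true ++ false :: u) = n := by
  induction n with
  | zero => rfl
  | succ n ih => simp [List.replicate_succ, leadingOnes, ih]

theorem stripOnes_replicate (n : ℕ) (u : List Bool) :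
    stripOnes n (List.replicate n true ++ false :: u) = some u := by
  induction n with
  | zero => rfl
  | succ n ih => simp [List.replicate_succ, stripOnes, ih]

theorem strictMonoWord_replicate (n : ℕ) :
    StrictMonoWord fun w => some (List.replicate n true ++ false :: w) := by
  intro u v a b huv hne ha hb
  simp only [Option.some.injEq] at ha hb
  subst ha hb
  exact ⟨by simpa using huv, by simpa using hne⟩

/-- The blocks of an element of `X^{(∞)}` are placed in the pairwise disjoint dyadic intervals
attached to the words `1ⁿ 0`, so every branch meets only one of them. -/
theorem pathSum_stripOnes_le (x : SLSum ∞) (w : List Bool) :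
    pathSum (fun u => (stripOnes (leadingOnes u) u).elim 0
      (wordCoeffₗ (x (leadingOnes u) : SLInfty))) w ≤ ‖x‖ ^ 2 := by
  have h := pathSum_pull_le (strictMonoWord_stripOnes (leadingOnes w))
    (x (leadingOnes w) : SLInfty) w
  refine le_trans (le_of_eq (Finset.sum_congr rfl fun u hu => ?_))
    (h.trans (pow_le_pow_left₀ (norm_nonneg _) (norm_block_le x _) 2))
  rcases leadingOnes_eq_or_stripOnes_eq_none (mem_inits_toFinset.mp hu) with h | h
  · exact congrArg (fun m => ((stripOnes m u).elim 0 (wordCoeffₗ (x m : SLInfty))) ^ 2) h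
  · simp only [h, Option.elim_none]

theorem idFactorsThrough_SLSum_SLInfty : IdFactorsThrough (SLSum ∞) SLInfty := by
  let R : SLSum ∞ →L[ℝ] SLInfty := LinearMap.mkContinuous
    { toFun := fun x => ofWordCoeff _ ‖x‖ (pathSum_stripOnes_le x)
      map_add' := fun x y => SLInfty.ext_coeff fun w => by
        cases h : stripOnes (leadingOnes w) w <;> simp [h]
      map_smul' := fun c x => SLInfty.ext_coeff fun w => by
        cases h : stripOnes (leadingOnes w) w <;> simp [h] }
    1 fun x => (norm_ofWordCoeff_le _ (norm_nonneg x) (pathSum_stripOnes_le x)).trans_eq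
      (one_mul _).symm
  have hR : ∀ x w, wordCoeffₗ (R x) w = (stripOnes (leadingOnes w) w).elim 0
      (wordCoeffₗ (x (leadingOnes w) : SLInfty)) := fun x w => by simp [R]
  let S : SLInfty →L[ℝ] SLSum ∞ := lpOfComponents
    (fun n => (pullFin n _ (strictMonoWord_replicate n)).toLinearMap) 1 zero_le_one
    fun f => ⟨fun _ n => (norm_pullFin_le _ _ _ f).trans_eq (one_mul _).symm,
      fun h => absurd rfl h⟩
  have hS : ∀ f n, S f n = pullFin n _ (strictMonoWord_replicate n) f := fun f n => rfl
  refine ⟨R, S, fun x => SLSum.ext_coeff fun n w => ?_⟩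
  rw [hS, wordCoeff_pullFin]
  split_ifs with h
  · rw [Option.elim_some, hR]
    have key : ∀ m, m = n → (stripOnes m (List.replicate n true ++ false :: w)).elim 0
        (wordCoeffₗ (x m : SLInfty)) = wordCoeffₗ (x n : SLInfty) w := by
      rintro m rfl
      rw [stripOnes_replicate, Option.elim_some]
    exact key _ (leadingOnes_replicate n w)
  · exact (wordCoeff_eq_zero _ (not_le.mp h)).symm

theorem exists_tendsto_hyperfilter (x : SLSum ∞) (w : List Bool) :
    ∃ a, Filter.Tendsto (fun n => wordCoeffₗ (x n : SLInfty) w) (Filter.hyperfilter ℕ)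
      (nhds a) := by
  obtain ⟨a, _, ha⟩ := (isCompact_Icc (a := -‖x‖) (b := ‖x‖)).ultrafilter_le_nhds
    ((Filter.hyperfilter ℕ).map fun n => wordCoeffₗ (x n : SLInfty) w) (by
      refine Filter.le_principal_iff.mpr (Filter.mem_map.mpr
        (Filter.Eventually.of_forall fun n => ?_))
      exact abs_le.mp ((abs_wordCoeff_le _ w).trans (norm_block_le x n)))
  exact ⟨a, ha⟩

/-- `SL^∞` embeds into `X^{(∞)}` by truncations; the coordinatewise limit along a free ultrafilter
is a left inverse. -/
theorem idFactorsThrough_SLInfty_SLSum : IdFactorsThrough SLInfty (SLSum ∞) := by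
  let R : SLInfty →L[ℝ] SLSum ∞ := lpOfComponents (fun n => (trunc n).toLinearMap) 1 zero_le_one
    fun f => ⟨fun _ n => (norm_trunc_le n f).trans_eq (one_mul _).symm, fun h => absurd rfl h⟩
  have hR : ∀ f n, R f n = trunc n f := fun f n => rfl
  choose c hc using exists_tendsto_hyperfilter
  have hcsum : ∀ x w, pathSum (c x) w ≤ ‖x‖ ^ 2 := fun x w => by
    refine le_of_tendsto (tendsto_finsetSum _ fun u _ => (hc x u).pow 2)
      (Filter.Eventually.of_forall fun n => ?_)
    exact (pathSum_le (x n : SLInfty) w).trans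
      (pow_le_pow_left₀ (norm_nonneg _) (norm_block_le x n) 2)
  let S : SLSum ∞ →L[ℝ] SLInfty := LinearMap.mkContinuous
    { toFun := fun x => ofWordCoeff (c x) ‖x‖ (hcsum x)
      map_add' := fun x y => SLInfty.ext_coeff fun w => by
        simpa using tendsto_nhds_unique (hc (x + y) w)
          (by simpa using (hc x w).add (hc y w))
      map_smul' := fun b x => SLInfty.ext_coeff fun w => by
        simpa using tendsto_nhds_unique (hc (b • x) w)
          (by simpa using (hc x w).const_mul b) }
    1 fun x => (norm_ofWordCoeff_le _ (norm_nonneg x) (hcsum x)).trans_eq (one_mul _).symm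
  have hS : ∀ x w, wordCoeffₗ (S x) w = c x w := fun x w => by simp [S]
  refine ⟨R, S, fun f => SLInfty.ext_coeff fun w => ?_⟩
  rw [hS]
  refine tendsto_nhds_unique (hc (R f) w) (tendsto_const_nhds.congr' ?_)
  filter_upwards [Filter.Tendsto.eventually_ge_atTop
    (Filter.tendsto_id.mono_left Nat.hyperfilter_le_atTop) w.length] with n hn
  rw [hR, wordCoeff_trunc, if_pos (by exact hn)]

/-! ### Functionals on `ℓ^p`-sums along an infinite set of coordinates -/

section AlmostDisjoint

/-- The `α`-th member of an almost disjoint family of infinite sets of natural numbers, indexed by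
infinite `0`-`1` sequences: the codes of the initial segments of `α`. -/
def branchSet (α : ℕ → Bool) : Set ℕ := range fun n => Encodable.encode ((List.range n).map α)

theorem infinite_branchSet (α : ℕ → Bool) : (branchSet α).Infinite := by
  refine infinite_range_of_injective fun n m h => ?_
  simpa using congrArg List.length (Encodable.encode_injective h)

theorem finite_branchSet_inter {α β : ℕ → Bool} (h : α ≠ β) :
    (branchSet α ∩ branchSet β).Finite := by
  obtain ⟨j, hj⟩ := Function.ne_iff.mp h
  refine ((Set.finite_Iic j).image fun n => Encodable.encode ((List.range n).map α)).subset ?_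
  rintro _ ⟨⟨n, rfl⟩, ⟨m, hm⟩⟩
  have h1 := Encodable.encode_injective hm
  obtain rfl : m = n := by simpa using congrArg List.length h1
  refine ⟨m, ?_, rfl⟩
  by_contra hlt
  exact hj ((List.map_inj_left.mp h1 j (List.mem_range.mpr (not_le.mp hlt))).symm)

variable {E : ℕ → Type*} [∀ i, NormedAddCommGroup (E i)] [∀ i, NormedSpace ℝ (E i)]

/-- However large the finite set `F`, the functional `θ` takes a value exceeding `δ` at a vector of
norm at most one supported in `branchSet α` off `F`. -/
def LargeAlong (θ : lp E ∞ →L[ℝ] ℝ) (δ : ℝ) (α : ℕ → Bool) : Prop :=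
  ∀ F : Finset ℕ, ∃ x : lp E ∞, (∀ i, i ∉ branchSet α ∨ i ∈ F → x i = 0) ∧ ‖x‖ ≤ 1 ∧ δ < θ x

/-- Off a finite set, finitely many of the sets `branchSet α` are pairwise disjoint, and the sum of
unit vectors with disjoint supports has norm at most one. -/
theorem finite_largeAlong (θ : lp E ∞ →L[ℝ] ℝ) {δ : ℝ} (hδ : 0 < δ) :
    {α | LargeAlong θ δ α}.Finite := by
  classical
  by_contra hinf
  obtain ⟨n, hn⟩ := exists_nat_gt (‖θ‖ / δ)
  rw [div_lt_iff₀ hδ] at hn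
  obtain ⟨t, ht, hcard⟩ := Set.Infinite.exists_subset_card_eq hinf n
  have hfin : (⋃ α ∈ t, ⋃ β ∈ t.filter (· ≠ α), branchSet α ∩ branchSet β).Finite :=
    Finset.finite_toSet t |>.biUnion fun α _ => (Finset.finite_toSet _).biUnion fun β hβ =>
      finite_branchSet_inter (Finset.mem_filter.mp hβ).2.symm
  have hx : ∀ α ∈ t, ∃ x : lp E ∞, (∀ i, i ∉ branchSet α ∨ i ∈ hfin.toFinset → x i = 0) ∧
      ‖x‖ ≤ 1 ∧ δ < θ x := fun α hα => ht hα _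
  choose! x hx0 hx1 hxδ using hx
  have hdisj : ∀ α ∈ t, ∀ β ∈ t, β ≠ α → ∀ i, x α i ≠ 0 → x β i = 0 := by
    intro α hα β hβ hne i hi
    have h1 : i ∈ branchSet α ∧ i ∉ hfin.toFinset := by
      by_contra hcon
      exact hi (hx0 α hα i (by tauto))
    refine hx0 β hβ i (Or.inl fun h2 => h1.2 (hfin.mem_toFinset.mpr ?_))
    exact mem_biUnion (Finset.mem_coe.mpr hα)
      (mem_biUnion (Finset.mem_coe.mpr (Finset.mem_filter.mpr ⟨hβ, hne⟩)) ⟨h1.1, h2⟩)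
  have hnorm : ‖∑ α ∈ t, x α‖ ≤ 1 := by
    refine lp.norm_le_of_forall_le zero_le_one fun i => ?_
    rw [lp.coeFn_sum, Finset.sum_apply]
    by_cases hall : ∀ α ∈ t, x α i = 0
    · rw [Finset.sum_eq_zero hall, norm_zero]
      exact zero_le_one
    · push Not at hall
      obtain ⟨α, hα, hi⟩ := hall
      rw [Finset.sum_eq_single_of_mem α hα fun β hβ hne => hdisj α hα β hβ hne i hi]
      exact (lp.norm_apply_le_norm ENNReal.top_ne_zero (x α) i).trans (hx1 α hα)
  have hlow : (n : ℝ) * δ ≤ θ (∑ α ∈ t, x α) := by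
    rw [map_sum, ← hcard, ← nsmul_eq_mul]
    exact Finset.card_nsmul_le_sum _ _ _ fun α hα => (hxδ α hα).le
  have hup : θ (∑ α ∈ t, x α) ≤ ‖θ‖ :=
    (le_abs_self _).trans ((θ.le_opNorm _).trans (mul_le_of_le_one_right (norm_nonneg θ) hnorm))
  linarith

theorem hasSum_of_not_largeAlong {θ : lp E ∞ →L[ℝ] ℝ} {α : ℕ → Bool}
    (h : ∀ k : ℕ, ¬ LargeAlong θ (1 / (k + 1)) α) {x : lp E ∞}
    (hx : ∀ i, i ∉ branchSet α → x i = 0) :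
    HasSum (fun i => θ (lp.single ∞ i (x i))) (θ x) := by
  rw [HasSum, Metric.tendsto_nhds, SummationFilter.unconditional_filter]
  intro ε hε
  have hc : 0 < ‖x‖ + 1 := by positivity
  obtain ⟨k, hk⟩ := exists_nat_one_div_lt (div_pos hε hc)
  obtain ⟨F, hF⟩ := not_forall.mp (h k)
  push Not at hF
  refine Filter.eventually_atTop.mpr ⟨F, fun G hG => ?_⟩
  set z : lp E ∞ := x - ∑ i ∈ G, lp.single ∞ i (x i) with hz
  have hzi : ∀ i, z i = if i ∈ G then 0 else x i := by
    intro i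
    simp only [hz, lp.coeFn_sub, lp.coeFn_sum, Pi.sub_apply, Finset.sum_apply, lp.single_apply,
      Finset.sum_pi_single]
    split_ifs <;> simp
  have hznorm : ‖z‖ ≤ ‖x‖ := by
    refine lp.norm_le_of_forall_le (norm_nonneg x) fun i => ?_
    rw [hzi]
    split_ifs
    · simp
    · exact lp.norm_apply_le_norm ENNReal.top_ne_zero x i
  have hbound : ∀ s : ℝ, |s| = 1 → θ (s • z) < ε := by
    intro s hs
    have h1 := hF (((‖x‖ + 1)⁻¹ * s) • z) (fun i hi => by
      have : z i = 0 := by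
        rw [hzi]
        rcases hi with hi | hi
        · rw [hx i hi, ite_self]
        · rw [if_pos (hG hi)]
      simp [this]) (by
      rw [norm_smul, norm_mul, Real.norm_eq_abs s, hs, mul_one, norm_inv, Real.norm_of_nonneg hc.le,
        inv_mul_le_iff₀ hc]
      linarith)
    rw [mul_smul, map_smul, smul_eq_mul, inv_mul_le_iff₀ hc] at h1
    refine h1.trans_lt ?_
    rw [mul_comm]
    exact (lt_div_iff₀ hc).mp hk
  have heq : (∑ i ∈ G, θ (lp.single ∞ i (x i))) - θ x = -θ z := by
    rw [hz, map_sub, map_sum]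
    ring
  rw [Real.dist_eq, heq, abs_neg, abs_lt]
  have h1 := hbound 1 (by simp)
  have h2 := hbound (-1) (by simp)
  simp only [one_smul, neg_smul, map_neg] at h1 h2
  constructor <;> linarith

/-- Given countably many functionals on an `ℓ^p`-sum, there is an infinite set `Λ` of coordinates
such that on vectors supported in `Λ` all of them are determined by their restrictions to the
summands. This is only an issue for `p = ∞`, where each functional, in any accuracy, is bad for
finitely many members of an uncountable almost disjoint family only. -/
theorem exists_infinite_forall_hasSum (p : ℝ≥0∞) [Fact (1 ≤ p)] {κ : Type*} [Countable κ]
    (θ : κ → lp E p →L[ℝ] ℝ) :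
    ∃ Λ : Set ℕ, Λ.Infinite ∧ ∀ (x : lp E p), (∀ i, i ∉ Λ → x i = 0) →
      ∀ k, HasSum (fun i => θ k (lp.single p i (x i))) (θ k x) := by
  by_cases hp : p = ∞
  · subst hp
    have hcount : (⋃ k : κ, ⋃ n : ℕ, {α | LargeAlong (θ k) (1 / ((n : ℝ) + 1)) α}).Countable :=
      countable_iUnion fun k => countable_iUnion fun n =>
        (finite_largeAlong (θ k) (by positivity)).countable
    obtain ⟨α, hα⟩ : ∃ α, α ∉ ⋃ k : κ, ⋃ n : ℕ, {α | LargeAlong (θ k) (1 / ((n : ℝ) + 1)) α} := by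
      by_contra! hall
      rw [eq_univ_of_forall hall] at hcount
      have : Uncountable (ℕ → Bool) := by
        rw [← Cardinal.aleph0_lt_mk_iff]
        simpa using Cardinal.cantor Cardinal.aleph0
      exact not_countable_univ hcount
    simp only [mem_iUnion, mem_ofPred_eq, not_exists] at hα
    exact ⟨branchSet α, infinite_branchSet α, fun x hx k => hasSum_of_not_largeAlong (hα k) hx⟩
  · exact ⟨univ, infinite_univ, fun x _ k => (lp.hasSum_single hp x).mapL (θ k)⟩

end AlmostDisjoint

/-! ### Matrix entries of operators on `X^{(r)}` -/

section Entries

variable {r : ℝ≥0∞} [Fact (1 ≤ r)]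

/-- A single coefficient of a single block, as a functional on `X^{(r)}`. -/
noncomputable def coeffCLM (r : ℝ≥0∞) [Fact (1 ≤ r)] (n : ℕ) (w : List Bool) : SLSum r →L[ℝ] ℝ :=
  LinearMap.mkContinuous (LinearMap.proj w ∘ₗ wordCoeffₗ ∘ₗ (blockCLM r n).toLinearMap) 1
    fun x => by
      rw [one_mul]
      exact (abs_wordCoeff_le _ w).trans (norm_block_le x n)

theorem coeffCLM_apply (n : ℕ) (w : List Bool) (x : SLSum r) :
    coeffCLM r n w x = wordCoeffₗ (x n : SLInfty) w := rfl

theorem norm_coeffCLM_le (n : ℕ) (w : List Bool) : ‖coeffCLM r n w‖ ≤ 1 :=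
  LinearMap.mkContinuous_norm_le _ zero_le_one _

theorem abs_coeffCLM_le (n : ℕ) (w : List Bool) (x : SLSum r) : |coeffCLM r n w x| ≤ ‖x‖ :=
  (ContinuousLinearMap.le_of_opNorm_le _ (norm_coeffCLM_le n w) x).trans_eq (one_mul _)

/-- The inclusion of the `n`-th summand, precomposed with the projection of `SL^∞` onto it. -/
noncomputable def blockIncl (r : ℝ≥0∞) [Fact (1 ≤ r)] (n : ℕ) : SLInfty →L[ℝ] SLSum r :=
  lp.singleContinuousLinearMap ℝ (fun n : ℕ => SLInftyFin n) r n ∘L trunc n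

theorem norm_blockIncl_le (n : ℕ) (f : SLInfty) : ‖blockIncl r n f‖ ≤ ‖f‖ := by
  rw [blockIncl, ContinuousLinearMap.comp_apply, lp.singleContinuousLinearMap_apply,
    lp.norm_single (zero_lt_one.trans_le Fact.out)]
  exact norm_trunc_le n f

theorem blockIncl_coe (n : ℕ) (f : SLInftyFin n) :
    blockIncl r n (f : SLInfty) = lp.single r n f := by
  have : trunc n (f : SLInfty) = f := Subtype.ext <| SLInfty.ext_coeff fun w => by
    rw [wordCoeff_trunc]
    split_ifs with h
    · rfl
    · exact (wordCoeff_eq_zero f (not_le.mp h)).symm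
  simp [blockIncl, this]

/-- The entry of the matrix of `T` at the row `(m, u)` and the column `(i, w)`. It vanishes if `w`
is longer than `i` or `u` is longer than `m`. -/
noncomputable def entry (T : SLSum r →L[ℝ] SLSum r) (m : ℕ) (u : List Bool) (i : ℕ)
    (w : List Bool) : ℝ :=
  coeffCLM r m u (T (blockIncl r i (wordHaar w)))

/-- Bessel's inequality for functionals, from the upper `ℓ²` estimate for Haar functions. -/
theorem sum_sq_functional_le (θ : SLSum r →L[ℝ] ℝ) (i : ℕ) (s : Finset (List Bool)) :
    ∑ u ∈ s, θ (blockIncl r i (wordHaar u)) ^ 2 ≤ ‖θ‖ ^ 2 := by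
  set a : List Bool → ℝ := fun u => θ (blockIncl r i (wordHaar u)) with ha
  set q := ∑ u ∈ s, a u ^ 2 with hq
  have hq0 : 0 ≤ q := Finset.sum_nonneg fun _ _ => sq_nonneg _
  have h1 : θ (blockIncl r i (∑ u ∈ s, a u • wordHaar u)) = q := by
    simp only [map_sum, map_smul, smul_eq_mul, hq, sq, ha]
  have h2 : q ≤ ‖θ‖ * √q := by
    rw [← h1]
    refine (le_abs_self _).trans ((θ.le_opNorm _).trans ?_)
    rw [h1]
    exact mul_le_mul_of_nonneg_left ((norm_blockIncl_le _ _).trans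
      (norm_sum_smul_wordHaar_le s a)) (norm_nonneg θ)
  change q ≤ ‖θ‖ ^ 2
  have h3 := Real.sq_sqrt hq0
  have h4 := Real.sqrt_nonneg q
  have h5 := norm_nonneg θ
  rcases h4.eq_or_lt with h | h
  · rw [← h3, ← h]
    nlinarith
  · have : √q ≤ ‖θ‖ := by
      by_contra! hlt
      nlinarith
    rw [← h3]
    exact pow_le_pow_left₀ h4 this 2

theorem leftChain_injective (v : List Bool) : Function.Injective (leftChain v) := by
  intro i j h
  simpa [leftChain] using congrArg List.length h

theorem leftChain_prefix (v : List Bool) {i j : ℕ} (h : i ≤ j) :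
    leftChain v i <+: leftChain v j :=
  ⟨List.replicate (j - i) false, by simp [leftChain, h]⟩

theorem sum_sq_coeff_leftChain_le (x : SLSum r) (m : ℕ) (v : List Bool) (L : ℕ) :
    ∑ j ∈ Finset.range L, coeffCLM r m (leftChain v j) x ^ 2 ≤ ‖x‖ ^ 2 := by
  classical
  have h := sum_sq_le_of_chain (x m : SLInfty)
    (s := (Finset.range L).image (leftChain v)) (w := leftChain v L) (by
      intro u hu
      obtain ⟨j, hj, rfl⟩ := Finset.mem_image.mp hu
      exact leftChain_prefix v (Finset.mem_range.mp hj).le)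
  rw [Finset.sum_image (leftChain_injective v).injOn] at h
  exact h.trans (pow_le_pow_left₀ (norm_nonneg _) (norm_block_le x m) 2)

/-- The interaction of two Haar functions under `T`: the sum of the squares of the two matrix
entries that they determine. -/
noncomputable def pairCost (T : SLSum r →L[ℝ] SLSum r) (m : ℕ) (u : List Bool) (i : ℕ)
    (w : List Bool) : ℝ :=
  entry T m u i w ^ 2 + entry T i w m u ^ 2

theorem pairCost_nonneg (T : SLSum r →L[ℝ] SLSum r) (m : ℕ) (u : List Bool) (i : ℕ)
    (w : List Bool) : 0 ≤ pairCost T m u i w := by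
  unfold pairCost
  positivity

theorem pairCost_comm (T : SLSum r →L[ℝ] SLSum r) (m : ℕ) (u : List Bool) (i : ℕ)
    (w : List Bool) : pairCost T m u i w = pairCost T i w m u := add_comm _ _

theorem abs_entry_le_of_pairCost_le {T : SLSum r →L[ℝ] SLSum r} {m i : ℕ} {u w : List Bool}
    {ε : ℝ} (hε : 0 ≤ ε) (h : pairCost T m u i w ≤ ε ^ 2) :
    |entry T m u i w| ≤ ε ∧ |entry T i w m u| ≤ ε := by
  have h1 := sq_nonneg (entry T m u i w)
  have h2 := sq_nonneg (entry T i w m u)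
  unfold pairCost at h
  exact ⟨abs_le_of_sq_le_sq (by linarith) hε, abs_le_of_sq_le_sq (by linarith) hε⟩

theorem sum_pairCost_leftChain_le (T : SLSum r →L[ℝ] SLSum r) (i : ℕ) (w : List Bool) (m : ℕ)
    (v : List Bool) (L : ℕ) :
    ∑ j ∈ Finset.range L, pairCost T i w m (leftChain v j) ≤ 2 * ‖T‖ ^ 2 := by
  classical
  have hrow : ∑ j ∈ Finset.range L, entry T i w m (leftChain v j) ^ 2 ≤ ‖T‖ ^ 2 := by
    have h := sum_sq_functional_le (coeffCLM r i w ∘L T) m ((Finset.range L).image (leftChain v))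
    rw [Finset.sum_image (leftChain_injective v).injOn] at h
    refine h.trans (pow_le_pow_left₀ (norm_nonneg (coeffCLM r i w ∘L T)) ?_ 2)
    exact (ContinuousLinearMap.opNorm_comp_le _ _).trans
      (mul_le_of_le_one_left (norm_nonneg T) (norm_coeffCLM_le i w))
  have hcol : ∑ j ∈ Finset.range L, entry T m (leftChain v j) i w ^ 2 ≤ ‖T‖ ^ 2 := by
    refine (sum_sq_coeff_leftChain_le (T (blockIncl r i (wordHaar w))) m v L).trans
      (pow_le_pow_left₀ (norm_nonneg _) ((T.le_opNorm _).trans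
        (mul_le_of_le_one_right (norm_nonneg T) ?_)) 2)
    exact (norm_blockIncl_le _ _).trans (norm_wordHaar_le w)
  simp only [pairCost, Finset.sum_add_distrib]
  linarith

/-! ### Choice of an almost diagonal system of Haar functions -/

/-- Far out in `Λ` there is a block containing a dyadic tree of Haar functions on which `T` is
almost diagonal, which hardly interacts with finitely many given Haar functions, and on which
either all diagonal entries of `T` are at least `1/2` or all of them are less than `1/2`. -/
theorem exists_block_tree (T : SLSum r →L[ℝ] SLSum r) {Λ : Set ℕ} (hΛ : Λ.Infinite)
    (s : Finset (ℕ × List Bool)) (M d : ℕ) {ε : ℝ} (hε : 0 < ε) :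
    ∃ m ∈ Λ, M < m ∧ ∃ φ, IsTreeEmb (d + 1) φ ∧
      (∀ J : List Bool, J.length < d + 1 → (φ J).length ≤ m) ∧
      (∀ a ∈ s, ∀ J : List Bool, J.length < d + 1 →
        |entry T a.1 a.2 m (φ J)| ≤ ε ∧ |entry T m (φ J) a.1 a.2| ≤ ε) ∧
      (∀ I J : List Bool, I.length < d + 1 → J.length < d + 1 → I ≠ J →
        |entry T m (φ I) m (φ J)| ≤ ε) ∧
      ((∀ J : List Bool, J.length < d + 1 → 1 / 2 ≤ |entry T m (φ J) m (φ J)|) ∨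
        (∀ J : List Bool, J.length < d + 1 → |entry T m (φ J) m (φ J)| < 1 / 2)) := by
  obtain ⟨N, hN⟩ := exists_sparse_tree (2 * ‖T‖ ^ 2) (pow_pos hε 2) ((d + 1) + (d + 1))
    (s.card * (2 * ‖T‖ ^ 2))
  obtain ⟨m, hm, hmN⟩ := hΛ.exists_gt (max M N)
  obtain ⟨φ, hφ, hφs, hφφ⟩ := hN (fun u w => pairCost T m u m w)
    (fun w => ∑ a ∈ s, pairCost T a.1 a.2 m w) []
    (fun u w => pairCost_nonneg T m u m w) (fun u w => pairCost_comm T m u m w)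
    (fun u v L => sum_pairCost_leftChain_le T m u m v L)
    (fun w => Finset.sum_nonneg fun _ _ => pairCost_nonneg _ _ _ _ _)
    (fun v L => by
      rw [Finset.sum_comm, ← nsmul_eq_mul]
      exact Finset.sum_le_card_nsmul _ _ _ fun a _ => sum_pairCost_leftChain_le T a.1 a.2 m v L)
  have hwork : ∀ θ : List Bool → List Bool, IsTreeEmb (d + 1) θ →
      (∀ J : List Bool, J.length < d + 1 → (θ J).length < (d + 1) + (d + 1)) →
      IsTreeEmb (d + 1) (φ ∘ θ) ∧
      (∀ J : List Bool, J.length < d + 1 → (φ (θ J)).length ≤ m) ∧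
      (∀ a ∈ s, ∀ J : List Bool, J.length < d + 1 →
        |entry T a.1 a.2 m (φ (θ J))| ≤ ε ∧ |entry T m (φ (θ J)) a.1 a.2| ≤ ε) ∧
      (∀ I J : List Bool, I.length < d + 1 → J.length < d + 1 → I ≠ J →
        |entry T m (φ (θ I)) m (φ (θ J))| ≤ ε) := by
    intro θ hθ hlen
    refine ⟨hφ.comp hθ hlen, fun J hJ => ?_, fun a ha J hJ => ?_, fun I J hI hJ hIJ => ?_⟩
    · have := (hφs (θ J) (hlen J hJ)).2.1
      simp only [List.length_nil, zero_add] at this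
      exact this.trans ((le_max_right M N).trans hmN.le)
    · have h : ∑ a ∈ s, pairCost T a.1 a.2 m (φ (θ J)) ≤ ε ^ 2 := (hφs (θ J) (hlen J hJ)).2.2
      have hnn : ∀ b ∈ s, 0 ≤ pairCost T b.1 b.2 m (φ (θ J)) :=
        fun b _ => pairCost_nonneg T b.1 b.2 m (φ (θ J))
      have h' : pairCost T a.1 a.2 m (φ (θ J)) ≤ ε ^ 2 := (Finset.single_le_sum hnn ha).trans h
      exact abs_entry_le_of_pairCost_le hε.le h'
    · have h : pairCost T m (φ (θ I)) m (φ (θ J)) ≤ ε ^ 2 :=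
        hφφ _ _ (hlen I hI) (hlen J hJ) fun h => hIJ (hθ.injective hI hJ h)
      exact (abs_entry_le_of_pairCost_le hε.le h).1
  refine ⟨m, hm, (le_max_left M N).trans_lt hmN, ?_⟩
  rcases exists_monochromatic_tree (fun w => 1 / 2 ≤ |entry T m (φ w) m (φ w)|) _ (d + 1) (d + 1)
    [] le_rfl with ⟨θ, hθ, hχ⟩ | ⟨θ, hθ, hχ⟩
  · obtain ⟨h1, h2, h3, h4⟩ := hwork θ hθ fun J hJ => by simpa using (hχ J hJ).2.1
    exact ⟨φ ∘ θ, h1, h2, h3, h4, Or.inl fun J hJ => (hχ J hJ).2.2⟩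
  · obtain ⟨h1, h2, h3, h4⟩ := hwork θ hθ fun J hJ => by simpa using (hχ J hJ).2.1
    exact ⟨φ ∘ θ, h1, h2, h3, h4, Or.inr fun J hJ => not_le.mp (hχ J hJ).2.2⟩

/-- The number of words of length at most `n`, times `2ⁿ⁺¹`. A matrix with entries bounded by
`ρ / (blockWeight n * blockWeight i)` at the positions `((n, I), (i, J))` defines an operator of norm
at most `ρ`. -/
noncomputable def blockWeight (n : ℕ) : ℝ := (shortWords (n + 1)).card * 2 ^ (n + 1)

theorem card_shortWords_pos (n : ℕ) : 0 < (shortWords (n + 1)).card :=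
  Finset.card_pos.mpr ⟨[], by simp⟩

theorem blockWeight_pos (n : ℕ) : 0 < blockWeight n :=
  mul_pos (Nat.cast_pos.mpr (card_shortWords_pos n)) (by positivity)

theorem blockWeight_mono : Monotone blockWeight := by
  intro n m h
  unfold blockWeight
  have : (shortWords (n + 1)).card ≤ (shortWords (m + 1)).card :=
    Finset.card_le_card fun w hw => by
      rw [mem_shortWords] at hw ⊢
      omega
  gcongr
  norm_num

/-- A sequence of tree embeddings, the `n`-th one mapping the tree of `SL^∞_n` into the tree of
the block `block n`, such that `T` is almost diagonal on the union of their images. -/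
structure SparseSystem (T : SLSum r →L[ℝ] SLSum r) (Λ : Set ℕ) (ρ : ℝ) where
  /-- The blocks that are used. -/
  block : ℕ → ℕ
  /-- The tree embeddings. -/
  emb : ℕ → List Bool → List Bool
  block_mem : ∀ n, block n ∈ Λ
  block_strictMono : StrictMono block
  isTreeEmb : ∀ n, IsTreeEmb (n + 1) (emb n)
  length_le : ∀ n (J : List Bool), J.length < n + 1 → (emb n J).length ≤ block n
  offDiag : ∀ n i (I J : List Bool), I.length < n + 1 → J.length < i + 1 → (n, I) ≠ (i, J) →
    |entry T (block n) (emb n I) (block i) (emb i J)| ≤ ρ / (blockWeight n * blockWeight i)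

theorem exists_sparseSystem (T : SLSum r →L[ℝ] SLSum r) {Λ : Set ℕ} (hΛ : Λ.Infinite) {ρ : ℝ}
    (hρ : 0 < ρ) : ∃ s : SparseSystem T Λ ρ,
      (∀ n (J : List Bool), J.length < n + 1 →
        1 / 2 ≤ |entry T (s.block n) (s.emb n J) (s.block n) (s.emb n J)|) ∨
      (∀ n (J : List Bool), J.length < n + 1 →
        |entry T (s.block n) (s.emb n J) (s.block n) (s.emb n J)| < 1 / 2) := by
  classical
  let ε : ℕ → ℝ := fun d => ρ / (blockWeight d * blockWeight d)
  have hε : ∀ d, 0 < ε d := fun d => div_pos hρ (mul_pos (blockWeight_pos d) (blockWeight_pos d))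
  have hε' : ∀ {d n i : ℕ}, n ≤ d → i ≤ d → ε d ≤ ρ / (blockWeight n * blockWeight i) :=
    fun {d n i} hn hi => div_le_div_of_nonneg_left hρ.le
      (mul_pos (blockWeight_pos n) (blockWeight_pos i))
      (mul_le_mul (blockWeight_mono hn) (blockWeight_mono hi) (blockWeight_pos i).le
        (blockWeight_pos d).le)
  -- A triple consists of a depth, a block and a tree embedding.
  let Big : ℕ × ℕ × (List Bool → List Bool) → Prop := fun y =>
    ∀ J : List Bool, J.length < y.1 + 1 → 1 / 2 ≤ |entry T y.2.1 (y.2.2 J) y.2.1 (y.2.2 J)|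
  let Small : ℕ × ℕ × (List Bool → List Bool) → Prop := fun y =>
    ∀ J : List Bool, J.length < y.1 + 1 → |entry T y.2.1 (y.2.2 J) y.2.1 (y.2.2 J)| < 1 / 2
  obtain ⟨f, hf, hff⟩ := exists_seq_of_forall_finset_exists
    (fun y : ℕ × ℕ × (List Bool → List Bool) => y.2.1 ∈ Λ ∧ IsTreeEmb (y.1 + 1) y.2.2 ∧
      (∀ J : List Bool, J.length < y.1 + 1 → (y.2.2 J).length ≤ y.2.1) ∧
      (∀ I J : List Bool, I.length < y.1 + 1 → J.length < y.1 + 1 → I ≠ J →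
        |entry T y.2.1 (y.2.2 I) y.2.1 (y.2.2 J)| ≤ ε y.1) ∧ (Big y ∨ Small y))
    (fun x y => x.1 < y.1 ∧ x.2.1 < y.2.1 ∧
      ∀ I J : List Bool, I.length < x.1 + 1 → J.length < y.1 + 1 →
        |entry T x.2.1 (x.2.2 I) y.2.1 (y.2.2 J)| ≤ ε y.1 ∧
        |entry T y.2.1 (y.2.2 J) x.2.1 (x.2.2 I)| ≤ ε y.1)
    (fun s _ => by
      let d := s.sup (fun x => x.1) + 1
      obtain ⟨m, hm, hMm, φ, h1, h2, h3, h4, h5⟩ := exists_block_tree T hΛ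
        (s.biUnion fun x => (shortWords (x.1 + 1)).image fun J => (x.2.1, x.2.2 J))
        (s.sup fun x => x.2.1) d (hε d)
      refine ⟨(d, m, φ), ⟨hm, h1, h2, h4, h5⟩, fun x hx => ⟨?_, ?_, fun I J hI hJ => ?_⟩⟩
      · exact Nat.lt_succ_of_le (Finset.le_sup (f := fun x => x.1) hx)
      · exact (Finset.le_sup (f := fun x => x.2.1) hx).trans_lt hMm
      · exact h3 (x.2.1, x.2.2 I) (Finset.mem_biUnion.mpr ⟨x, hx,
          Finset.mem_image_of_mem _ (mem_shortWords.mpr hI)⟩) J hJ)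
  obtain ⟨k, hk, hkf⟩ : ∃ k : ℕ → ℕ, StrictMono k ∧
      ((∀ n, Big (f (k n))) ∨ (∀ n, Small (f (k n)))) := by
    have hfreq : (∃ᶠ n in Filter.atTop, Big (f n)) ∨ (∃ᶠ n in Filter.atTop, Small (f n)) := by
      rw [← Filter.frequently_or_distrib]
      exact (Filter.Eventually.of_forall fun n => (hf n).2.2.2.2).frequently
    rcases hfreq with h | h
    · obtain ⟨k, hk, h⟩ := Filter.extraction_of_frequently_atTop h
      exact ⟨k, hk, Or.inl h⟩
    · obtain ⟨k, hk, h⟩ := Filter.extraction_of_frequently_atTop h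
      exact ⟨k, hk, Or.inr h⟩
  have hdmono : StrictMono fun n => (f (k n)).1 := fun n m h => (hff _ _ (hk h)).1
  have hd : ∀ n, n ≤ (f (k n)).1 := fun n => hdmono.le_apply (x := n)
  have hlen : ∀ {n} {J : List Bool}, J.length < n + 1 → J.length < (f (k n)).1 + 1 :=
    fun {n J} hJ => hJ.trans_le (Nat.succ_le_succ (hd n))
  let S : SparseSystem T Λ ρ :=
    { block := fun n => (f (k n)).2.1
      emb := fun n => (f (k n)).2.2
      block_mem := fun n => (hf _).1
      block_strictMono := fun n m h => (hff _ _ (hk h)).2.1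
      isTreeEmb := fun n => (hf _).2.1.mono (Nat.succ_le_succ (hd n))
      length_le := fun n J hJ => (hf _).2.2.1 J (hlen hJ)
      offDiag := fun n i I J hI hJ hne => by
        rcases lt_trichotomy n i with h | rfl | h
        · exact (((hff _ _ (hk h)).2.2 I J (hlen hI) (hlen hJ)).1).trans
            (hε' (h.le.trans (hd i)) (hd i))
        · exact ((hf _).2.2.2.1 I J (hlen hI) (hlen hJ) (by simpa using hne)).trans
            (hε' (hd n) (hd n))
        · exact (((hff _ _ (hk h)).2.2 J I (hlen hJ) (hlen hI)).2).trans
            (hε' (hd n) (h.le.trans (hd n))) }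
  exact ⟨S, hkf.imp (fun h n J hJ => h n J (hlen hJ)) (fun h n J hJ => h n J (hlen hJ))⟩

end Entries

/-! ### Factorization of the identity through almost diagonal operators -/

namespace IsTreeEmb

variable {p : ℕ} {φ : List Bool → List Bool}

open Classical in
/-- The partial inverse of a tree embedding, defined on the images of words shorter than `p`. -/
noncomputable def inv (p : ℕ) (φ : List Bool → List Bool) (K : List Bool) : Option (List Bool) :=
  if h : ∃ I : List Bool, I.length < p ∧ φ I = K then some h.choose else none

theorem inv_eq_some {I K : List Bool} (h : inv p φ K = some I) : I.length < p ∧ φ I = K := by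
  unfold inv at h
  split_ifs at h with hex
  rw [← Option.some.inj h]
  exact hex.choose_spec

theorem inv_apply (h : IsTreeEmb p φ) {I : List Bool} (hI : I.length < p) :
    inv p φ (φ I) = some I := by
  have hex : ∃ I' : List Bool, I'.length < p ∧ φ I' = φ I := ⟨I, hI, rfl⟩
  rw [inv, dif_pos hex, h.injective hex.choose_spec.1 hI hex.choose_spec.2]

theorem strictMonoWord_inv (h : IsTreeEmb p φ) : StrictMonoWord (inv p φ) := by
  intro u v a b huv hne ha hb
  obtain ⟨ha', rfl⟩ := inv_eq_some ha
  obtain ⟨hb', rfl⟩ := inv_eq_some hb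
  exact ⟨h.prefix_of_prefix ha' hb' huv, fun hab => hne (hab ▸ rfl)⟩

/-- A tree embedding as a partial map defined on words shorter than `p`. -/
def restrict (p : ℕ) (φ : List Bool → List Bool) (I : List Bool) : Option (List Bool) :=
  if I.length < p then some (φ I) else none

theorem strictMonoWord_restrict (h : IsTreeEmb p φ) : StrictMonoWord (restrict p φ) := by
  intro u v a b huv hne ha hb
  simp only [restrict, Option.ite_none_right_eq_some, Option.some.injEq] at ha hb
  obtain ⟨_, rfl⟩ := ha
  obtain ⟨hv, rfl⟩ := hb
  have := h.prefix_and_length_lt hv huv hne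
  exact ⟨this.1, fun heq => this.2.ne (congrArg List.length heq)⟩

end IsTreeEmb

/-- An operator that is close to the identity has a left inverse of controlled norm. -/
theorem exists_leftInverse_of_norm_sub_le {X : Type*} [NormedAddCommGroup X] [NormedSpace ℝ X]
    [CompleteSpace X] (K : X →L[ℝ] X) {q : ℝ} (hq : q < 1)
    (hK : ‖K - ContinuousLinearMap.id ℝ X‖ ≤ q) :
    ∃ U : X →L[ℝ] X, U ∘L K = ContinuousLinearMap.id ℝ X ∧ ‖U‖ ≤ 1 / (1 - q) := by
  have hlt : ‖(1 : X →L[ℝ] X) - K‖ < 1 := by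
    rw [norm_sub_rev]
    exact hK.trans_lt hq
  obtain ⟨u, hu⟩ : IsUnit K := by
    have := isUnit_one_sub_of_norm_lt_one hlt
    rwa [sub_sub_cancel] at this
  set U : X →L[ℝ] X := ↑u⁻¹ with hU
  have hUK : U * K = 1 := by rw [hU, ← hu, Units.inv_mul]
  refine ⟨U, hUK, ?_⟩
  have h1 : U = 1 - U * (K - 1) := by rw [mul_sub, hUK, mul_one]; abel
  have h2 : ‖U‖ ≤ 1 + ‖U‖ * q := by
    calc ‖U‖ = ‖1 - U * (K - 1)‖ := by rw [← h1]
      _ ≤ ‖(1 : X →L[ℝ] X)‖ + ‖U * (K - 1)‖ := norm_sub_le _ _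
      _ ≤ 1 + ‖U‖ * q := add_le_add ContinuousLinearMap.norm_id_le
          ((norm_mul_le _ _).trans (mul_le_mul_of_nonneg_left hK (norm_nonneg U)))
  rw [le_div_iff₀ (by linarith)]
  linarith

namespace SparseSystem

variable {r : ℝ≥0∞} [Fact (1 ≤ r)] {H : SLSum r →L[ℝ] SLSum r} {Λ : Set ℕ} {ρ : ℝ}

/-- The embedding of `X^{(r)}` into itself along the given tree embeddings: the coefficient of the
block `n` at the word `J` moves to the block `block n` and the word `emb n J`. -/
noncomputable def embCLM (s : SparseSystem H Λ ρ) : SLSum r →L[ℝ] SLSum r :=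
  lpOfComponents (fun j => (Function.partialInv s.block j).elim 0 fun n =>
      (pullFin j _ (s.isTreeEmb n).strictMonoWord_inv ∘L blockCLM r n :
        _ →L[ℝ] SLInftyFin j).toLinearMap) 1 zero_le_one fun x => by
    have hinv := s.block_strictMono.injective.isPartialInv
    refine LpBound.of_le_comp x zero_le_one (Function.partialInv s.block)
      (fun j j' n h h' => ?_) fun j => ?_
    · rw [← (hinv n j).mp h, ← (hinv n j').mp h']
    · rw [one_mul]
      cases Function.partialInv s.block j with
      | none => simp
      | some n => exact norm_pullFin_le _ _ _ _

theorem norm_embCLM_le (s : SparseSystem H Λ ρ) : ‖s.embCLM‖ ≤ 1 := norm_lpOfComponents_le _ _ _ _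

theorem embCLM_apply (s : SparseSystem H Λ ρ) (x : SLSum r) (j : ℕ) :
    s.embCLM x j = ((Function.partialInv s.block j).elim 0 fun n =>
      (pullFin j _ (s.isTreeEmb n).strictMonoWord_inv ∘L blockCLM r n :
        _ →L[ℝ] SLInftyFin j).toLinearMap) x := rfl

theorem embCLM_block (s : SparseSystem H Λ ρ) (x : SLSum r) (n : ℕ) :
    s.embCLM x (s.block n) =
      pullFin (s.block n) _ (s.isTreeEmb n).strictMonoWord_inv (x n : SLInfty) := by
  have hinv := s.block_strictMono.injective.isPartialInv
  rw [embCLM_apply, (hinv n _).mpr rfl]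
  rfl

theorem embCLM_eq_zero (s : SparseSystem H Λ ρ) (x : SLSum r) {j : ℕ}
    (hj : j ∉ range s.block) : s.embCLM x j = 0 := by
  have hinv := s.block_strictMono.injective.isPartialInv
  have : Function.partialInv s.block j = none := by
    rw [Option.eq_none_iff_forall_not_mem]
    exact fun n hn => hj ⟨n, (hinv n j).mp hn⟩
  rw [embCLM_apply, this]
  rfl

theorem single_embCLM_block (s : SparseSystem H Λ ρ) (x : SLSum r) (n : ℕ) :
    lp.single r (s.block n) (s.embCLM x (s.block n)) = ∑ J ∈ shortWords (n + 1),
      wordCoeffₗ (x n : SLInfty) J • blockIncl r (s.block n) (wordHaar (s.emb n J)) := by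
  classical
  rw [← blockIncl_coe]
  simp only [← map_smul, ← map_sum]
  congr 1
  refine SLInfty.ext_coeff fun w => ?_
  rw [embCLM_block, wordCoeff_pullFin]
  simp only [map_sum, map_smul, Finset.sum_apply, Pi.smul_apply, wordCoeff_wordHaar, smul_eq_mul,
    mul_ite, mul_one, mul_zero]
  by_cases hw : ∃ J : List Bool, J.length < n + 1 ∧ s.emb n J = w
  · obtain ⟨J, hJ, rfl⟩ := hw
    rw [if_pos (s.length_le n J hJ), (s.isTreeEmb n).inv_apply hJ, Option.elim_some,
      Finset.sum_eq_single_of_mem J (mem_shortWords.mpr hJ), if_pos rfl]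
    intro I hI hne
    rw [if_neg fun h => hne ((s.isTreeEmb n).injective (mem_shortWords.mp hI) hJ h.symm)]
  · rw [IsTreeEmb.inv, dif_neg hw, Option.elim_none, ite_self, Finset.sum_eq_zero]
    intro J hJ
    rw [if_neg fun h => hw ⟨J, mem_shortWords.mp hJ, h.symm⟩]

/-- The reciprocals of the diagonal entries. -/
noncomputable def invDiag (s : SparseSystem H Λ ρ) (n : ℕ) (J : List Bool) : ℝ :=
  if J.length < n + 1 then (entry H (s.block n) (s.emb n J) (s.block n) (s.emb n J))⁻¹ else 0

/-- All diagonal entries are bounded away from zero. -/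
def LargeDiag (s : SparseSystem H Λ ρ) : Prop :=
  ∀ n (J : List Bool), J.length < n + 1 →
    1 / 2 ≤ |entry H (s.block n) (s.emb n J) (s.block n) (s.emb n J)|

theorem abs_invDiag_le {s : SparseSystem H Λ ρ} (hs : s.LargeDiag) (n : ℕ) (J : List Bool) :
    |s.invDiag n J| ≤ 2 := by
  unfold invDiag
  split_ifs with hJ
  · rw [abs_inv]
    exact (inv_anti₀ (by norm_num) (hs n J hJ)).trans_eq (by norm_num)
  · simp

/-- The left inverse of the embedding `embCLM`, followed by division by the diagonal of `H`. -/
noncomputable def projCLM (s : SparseSystem H Λ ρ) (hs : s.LargeDiag) :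
    SLSum r →L[ℝ] SLSum r :=
  lpOfComponents (fun n => (((pull _ (s.isTreeEmb n).strictMonoWord_restrict (s.invDiag n) 2
      (abs_invDiag_le hs n)).codRestrict (SLInftyFin n) fun f => mem_SLInftyFin_iff.mpr fun w hw =>
        by rw [wordCoeff_pull, invDiag, if_neg (by omega), zero_mul]) ∘L blockCLM r (s.block n) :
        _ →L[ℝ] SLInftyFin n).toLinearMap) 2 zero_le_two
    fun x => LpBound.of_le_comp x zero_le_two (fun n => some (s.block n))
      (fun n n' j h h' => s.block_strictMono.injective (Option.some.inj (h.trans h'.symm)))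
      fun n => norm_pull_apply_le _ (s.isTreeEmb n).strictMonoWord_restrict (s.invDiag n) 2
        (abs_invDiag_le hs n) (x (s.block n) : SLInfty)

theorem norm_projCLM_le (s : SparseSystem H Λ ρ) (hs : s.LargeDiag) : ‖s.projCLM hs‖ ≤ 2 :=
  norm_lpOfComponents_le _ _ _ _

theorem wordCoeff_projCLM (s : SparseSystem H Λ ρ) (hs : s.LargeDiag) (y : SLSum r) {n : ℕ}
    {I : List Bool} (hI : I.length < n + 1) : wordCoeffₗ (s.projCLM hs y n : SLInfty) I =
      (entry H (s.block n) (s.emb n I) (s.block n) (s.emb n I))⁻¹ *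
        coeffCLM r (s.block n) (s.emb n I) y := by
  change wordCoeffₗ (pull _ (s.isTreeEmb n).strictMonoWord_restrict (s.invDiag n) 2
    (abs_invDiag_le hs n) (y (s.block n) : SLInfty)) I = _
  rw [wordCoeff_pull, invDiag, if_pos hI, IsTreeEmb.restrict, if_pos hI]
  rfl

/-- Coefficients of vectors supported in `Λ` may be computed from the matrix of `H`. -/
def IsRegular (H : SLSum r →L[ℝ] SLSum r) (Λ : Set ℕ) : Prop :=
  ∀ x : SLSum r, (∀ i, i ∉ Λ → x i = 0) → ∀ m u,
    HasSum (fun i => coeffCLM r m u (H (lp.single r i (x i)))) (coeffCLM r m u (H x))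

theorem hasSum_coeff_embCLM (s : SparseSystem H Λ ρ) (hreg : IsRegular H Λ) (x : SLSum r)
    (m : ℕ) (u : List Bool) :
    HasSum (fun i => ∑ J ∈ shortWords (i + 1), wordCoeffₗ (x i : SLInfty) J *
      entry H m u (s.block i) (s.emb i J)) (coeffCLM r m u (H (s.embCLM x))) := by
  have h := hreg (s.embCLM x) (fun i hi => s.embCLM_eq_zero x fun ⟨n, hn⟩ =>
    hi (hn ▸ s.block_mem n)) m u
  rw [← s.block_strictMono.injective.hasSum_iff (fun j hj => by
    rw [s.embCLM_eq_zero x hj, lp.single_zero, map_zero, map_zero])] at h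
  refine h.congr_fun fun i => ?_
  simp only [Function.comp_apply, single_embCLM_block, map_sum, map_smul, smul_eq_mul]
  rfl

theorem abs_coeff_embCLM_sub_le (s : SparseSystem H Λ ρ) (hreg : IsRegular H Λ)
    (hρ : 0 ≤ ρ) (x : SLSum r) {n : ℕ} {I : List Bool} (hI : I.length < n + 1) :
    |coeffCLM r (s.block n) (s.emb n I) (H (s.embCLM x)) -
      wordCoeffₗ (x n : SLInfty) I * entry H (s.block n) (s.emb n I) (s.block n) (s.emb n I)| ≤
      ‖x‖ * (ρ / blockWeight n) := by
  classical
  have h := (s.hasSum_coeff_embCLM hreg x (s.block n) (s.emb n I)).sub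
    (hasSum_ite_eq n (wordCoeffₗ (x n : SLInfty) I *
      entry H (s.block n) (s.emb n I) (s.block n) (s.emb n I)))
  have hgeom : HasSum (fun i : ℕ => ‖x‖ * (ρ / blockWeight n) / 2 * (1 / 2 : ℝ) ^ i)
      (‖x‖ * (ρ / blockWeight n)) := by
    have := hasSum_geometric_two.mul_left (‖x‖ * (ρ / blockWeight n) / 2)
    rwa [div_mul_cancel₀ _ two_ne_zero] at this
  refine h.norm_le_of_bounded hgeom fun i => ?_
  have hterm : ∀ J ∈ shortWords (i + 1), (n, I) ≠ (i, J) →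
      |wordCoeffₗ (x i : SLInfty) J * entry H (s.block n) (s.emb n I) (s.block i) (s.emb i J)| ≤
        ‖x‖ * (ρ / (blockWeight n * blockWeight i)) := fun J hJ hne => by
    rw [abs_mul]
    exact mul_le_mul (abs_coeffCLM_le i J x) (s.offDiag n i I J hI (mem_shortWords.mp hJ) hne)
      (abs_nonneg _) (norm_nonneg x)
  have hρ0 : 0 ≤ ‖x‖ * (ρ / (blockWeight n * blockWeight i)) :=
    mul_nonneg (norm_nonneg x)
      (div_nonneg hρ (mul_pos (blockWeight_pos n) (blockWeight_pos i)).le)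
  have hcard : ((shortWords (i + 1)).card : ℝ) * (‖x‖ * (ρ / (blockWeight n * blockWeight i))) =
      ‖x‖ * (ρ / blockWeight n) / 2 * (1 / 2 : ℝ) ^ i := by
    have h1 : ((shortWords (i + 1)).card : ℝ) ≠ 0 := by
      exact_mod_cast (card_shortWords_pos i).ne'
    have h2 := (blockWeight_pos n).ne'
    rw [blockWeight.eq_def i, pow_succ, one_div_pow]
    field_simp
  rw [← hcard, ← nsmul_eq_mul]
  by_cases hin : i = n
  · subst hin
    rw [if_pos rfl, ← Finset.add_sum_erase _ _ (mem_shortWords.mpr hI), add_sub_cancel_left]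
    refine (norm_sum_le _ _).trans ((Finset.sum_le_card_nsmul _ _ _ fun J hJ => ?_).trans
      (nsmul_le_nsmul_left hρ0 (Finset.card_le_card (Finset.erase_subset I _))))
    exact hterm J (Finset.mem_of_mem_erase hJ) (by simpa using (Finset.ne_of_mem_erase hJ).symm)
  · rw [if_neg hin, sub_zero]
    refine (norm_sum_le _ _).trans (Finset.sum_le_card_nsmul _ _ _ fun J hJ => ?_)
    exact hterm J hJ fun h => hin (congrArg Prod.fst h).symm

theorem norm_projCLM_comp_sub_id_le (s : SparseSystem H Λ ρ) (hs : s.LargeDiag)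
    (hreg : IsRegular H Λ) (hρ : 0 ≤ ρ) :
    ‖s.projCLM hs ∘L H ∘L s.embCLM - ContinuousLinearMap.id ℝ (SLSum r)‖ ≤ 2 * ρ := by
  classical
  refine ContinuousLinearMap.opNorm_le_bound _ (by positivity) fun x => ?_
  have hblock : ∀ n, ‖(s.projCLM hs ∘L H ∘L s.embCLM - ContinuousLinearMap.id ℝ (SLSum r)) x n‖ ≤
      ρ * ‖x‖ * (1 / 2 : ℝ) ^ n := fun n => by
    refine (norm_le_card_mul (Subtype.property _) (C := 2 * (‖x‖ * (ρ / blockWeight n)))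
      fun I hI => ?_).trans_eq ?_
    · have he := hs n I hI
      set e := entry H (s.block n) (s.emb n I) (s.block n) (s.emb n I) with hedef
      have hcoeff : wordCoeffₗ (((s.projCLM hs ∘L H ∘L s.embCLM -
          ContinuousLinearMap.id ℝ (SLSum r)) x n : SLInftyFin n) : SLInfty) I =
          e⁻¹ * (coeffCLM r (s.block n) (s.emb n I) (H (s.embCLM x)) -
            wordCoeffₗ (x n : SLInfty) I * e) := by
        have he0 : e ≠ 0 := fun h0 => by rw [h0] at he; norm_num at he
        have h1 : wordCoeffₗ (((s.projCLM hs ∘L H ∘L s.embCLM -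
            ContinuousLinearMap.id ℝ (SLSum r)) x n : SLInftyFin n) : SLInfty) I =
            wordCoeffₗ (s.projCLM hs (H (s.embCLM x)) n : SLInfty) I -
              wordCoeffₗ (x n : SLInfty) I := rfl
        rw [h1, s.wordCoeff_projCLM hs _ hI, ← hedef, mul_sub]
        field_simp
      rw [hcoeff, abs_mul, abs_inv]
      refine mul_le_mul ?_ (s.abs_coeff_embCLM_sub_le hreg hρ x hI) (abs_nonneg _) zero_le_two
      exact (inv_anti₀ (by norm_num) he).trans_eq (by norm_num)
    · have h1 : ((shortWords (n + 1)).card : ℝ) ≠ 0 := by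
        exact_mod_cast (card_shortWords_pos n).ne'
      rw [blockWeight, pow_succ, one_div_pow]
      field_simp
  refine LpBound.norm_le (by positivity) (LpBound.of_sum_le fun t => ?_)
  refine (Finset.sum_le_sum fun n _ => hblock n).trans ?_
  rw [← Finset.mul_sum]
  have hgeom : ∑ n ∈ t, (1 / 2 : ℝ) ^ n ≤ 2 :=
    sum_le_hasSum t (fun _ _ => by positivity) hasSum_geometric_two
  have := mul_le_mul_of_nonneg_left hgeom (mul_nonneg hρ (norm_nonneg x))
  linarith

theorem exists_factorization (s : SparseSystem H Λ ρ) (hs : s.LargeDiag)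
    (hreg : IsRegular H Λ) (hρ : 0 ≤ ρ) (hρ1 : 2 * ρ < 1) :
    ∃ R S : SLSum r →L[ℝ] SLSum r, S ∘L H ∘L R = ContinuousLinearMap.id ℝ (SLSum r) ∧
      ‖R‖ * ‖S‖ ≤ 2 / (1 - 2 * ρ) := by
  obtain ⟨U, hU, hUnorm⟩ := exists_leftInverse_of_norm_sub_le _ hρ1
    (s.norm_projCLM_comp_sub_id_le hs hreg hρ)
  refine ⟨s.embCLM, U ∘L s.projCLM hs, hU, ?_⟩
  calc ‖s.embCLM‖ * ‖U ∘L s.projCLM hs‖ ≤ 1 * (1 / (1 - 2 * ρ) * 2) := by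
        refine mul_le_mul s.norm_embCLM_le ?_ (norm_nonneg (U ∘L s.projCLM hs)) zero_le_one
        exact (ContinuousLinearMap.opNorm_comp_le _ _).trans
          (mul_le_mul hUnorm (s.norm_projCLM_le hs) (norm_nonneg _)
            (one_div_nonneg.mpr (by linarith)))
    _ = 2 / (1 - 2 * ρ) := by ring

theorem coeff_blockIncl_wordHaar (m i : ℕ) (u w : List Bool) (hw : w.length ≤ i) :
    coeffCLM r m u (blockIncl r i (wordHaar w)) = if (m, u) = (i, w) then 1 else 0 := by
  have h1 : blockIncl r i (wordHaar w) = lp.single r i ⟨wordHaar w, wordHaar_mem hw⟩ :=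
    blockIncl_coe i ⟨wordHaar w, wordHaar_mem hw⟩
  rw [coeffCLM_apply, h1]
  by_cases hmi : m = i
  · subst hmi
    rw [lp.single_apply_self, wordCoeff_wordHaar]
    simp
  · rw [lp.single_apply_ne _ _ _ hmi, if_neg fun h => hmi (congrArg Prod.fst h)]
    simp

theorem entry_id_sub (T : SLSum r →L[ℝ] SLSum r) (m i : ℕ) (u w : List Bool)
    (hw : w.length ≤ i) :
    entry (ContinuousLinearMap.id ℝ (SLSum r) - T) m u i w =
      (if (m, u) = (i, w) then 1 else 0) - entry T m u i w := by
  rw [← coeff_blockIncl_wordHaar (r := r) m i u w hw]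
  simp [entry]

/-- A system on which `T` is almost diagonal also works for `Id - T`. -/
def compl {T : SLSum r →L[ℝ] SLSum r} (s : SparseSystem T Λ ρ) :
    SparseSystem (ContinuousLinearMap.id ℝ (SLSum r) - T) Λ ρ where
  block := s.block
  emb := s.emb
  block_mem := s.block_mem
  block_strictMono := s.block_strictMono
  isTreeEmb := s.isTreeEmb
  length_le := s.length_le
  offDiag n i I J hI hJ hne := by
    rw [entry_id_sub _ _ _ _ _ (s.length_le i J hJ), if_neg, zero_sub, abs_neg]
    · exact s.offDiag n i I J hI hJ hne
    · intro h
      obtain rfl := s.block_strictMono.injective (congrArg Prod.fst h)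
      exact hne (congrArg (Prod.mk n) ((s.isTreeEmb n).injective hI hJ (congrArg Prod.snd h)))

end SparseSystem

theorem SLSum.exists_factorization (r : ℝ≥0∞) [Fact (1 ≤ r)] (T : SLSum r →L[ℝ] SLSum r)
    {η : ℝ} (hη : 0 < η) :
    ∃ R S H : SLSum r →L[ℝ] SLSum r,
      (H = T ∨ H = ContinuousLinearMap.id ℝ (SLSum r) - T) ∧
      S ∘L H ∘L R = ContinuousLinearMap.id ℝ (SLSum r) ∧ ‖R‖ * ‖S‖ ≤ 2 + η := by
  obtain ⟨Λ, hΛ, hsum⟩ := exists_infinite_forall_hasSum r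
    (fun k : Bool × ℕ × List Bool => coeffCLM r k.2.1 k.2.2 ∘L
      (if k.1 then T else ContinuousLinearMap.id ℝ (SLSum r) - T))
  -- The value of `ρ` solves `2 / (1 - 2 * ρ) = 2 + η`.
  set ρ := η / (2 * (2 + η)) with hρdef
  have hρ : 0 < ρ := by positivity
  have hρ1 : 1 - 2 * ρ = 2 / (2 + η) := by
    rw [hρdef]
    field_simp
    ring
  have hpos : 0 < 2 / (2 + η) := by positivity
  have hρ2 : 2 / (1 - 2 * ρ) = 2 + η := by
    rw [hρ1]
    field_simp
  obtain ⟨s, hs | hs⟩ := exists_sparseSystem T hΛ hρ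
  · obtain ⟨R, S, h1, h2⟩ := s.exists_factorization hs
      (fun x hx m u => hsum x hx (true, m, u)) hρ.le (by linarith)
    exact ⟨R, S, T, Or.inl rfl, h1, h2.trans_eq hρ2⟩
  · have hs' : s.compl.LargeDiag := fun n J hJ => by
      change 1 / 2 ≤ |entry _ (s.block n) (s.emb n J) (s.block n) (s.emb n J)|
      rw [SparseSystem.entry_id_sub _ _ _ _ _ (s.length_le n J hJ), if_pos rfl]
      have h1 := hs n J hJ
      have h2 := abs_sub_abs_le_abs_sub 1 (entry T (s.block n) (s.emb n J) (s.block n) (s.emb n J))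
      rw [abs_one] at h2
      linarith
    obtain ⟨R, S, h1, h2⟩ := s.compl.exists_factorization hs'
      (fun x hx m u => hsum x hx (false, m, u)) hρ.le (by linarith)
    exact ⟨R, S, _, Or.inr rfl, h1, h2.trans_eq hρ2⟩

theorem mainTheorem1 :
    (∀ (r : ℝ≥0∞) [Fact (1 ≤ r)],
      (∀ (T : SLSum r →L[ℝ] SLSum r) (η : ℝ), 0 < η →
        ∃ R S H : SLSum r →L[ℝ] SLSum r,
          (H = T ∨ H = ContinuousLinearMap.id ℝ (SLSum r) - T) ∧
          S ∘L H ∘L R = ContinuousLinearMap.id ℝ (SLSum r) ∧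
          ‖R‖ * ‖S‖ ≤ 2 + η) ∧
      IsPrimaryBanach (SLSum r)) ∧
    IsPrimaryBanach SLInfty := by
  have hfac : ∀ (r : ℝ≥0∞) [Fact (1 ≤ r)] (T : SLSum r →L[ℝ] SLSum r),
      ∃ R S H : SLSum r →L[ℝ] SLSum r,
        (H = T ∨ H = ContinuousLinearMap.id ℝ (SLSum r) - T) ∧
          S ∘L H ∘L R = ContinuousLinearMap.id ℝ (SLSum r) := fun r _ T => by
    obtain ⟨R, S, H, hH, hS, -⟩ := SLSum.exists_factorization r T one_pos
    exact ⟨R, S, H, hH, hS⟩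
  refine ⟨fun r _ => ⟨fun T η hη => SLSum.exists_factorization r T hη,
    isPrimaryBanach_of_factorization r (ContinuousLinearEquiv.refl ℝ _)
      (idFactorsThrough_lp_SLSum r) (hfac r)⟩, ?_⟩
  -- By the decomposition method, both spaces are isomorphic to the `ℓ^∞`-sum of copies of
  -- `X^{(∞)}`.
  obtain ⟨e₁⟩ := idFactorsThrough_SLInfty_SLSum.nonempty_equiv_lp ∞
    ((idFactorsThrough_lp_SLSum ∞).trans idFactorsThrough_SLSum_SLInfty)
  obtain ⟨e₂⟩ := (ContinuousLinearEquiv.refl ℝ (SLSum ∞)).idFactorsThrough.nonempty_equiv_lp ∞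
    (idFactorsThrough_lp_SLSum ∞)
  exact isPrimaryBanach_of_factorization ∞ (e₁.trans e₂.symm) (idFactorsThrough_lp_SLSum ∞)
    (hfac ∞)
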